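/- Let $\nu\ge 1$ and let $\|w\|$ denote the max-norm on $\mathbb Z^\nu$. Let $A:\mathbb Z^\nu\to\mathbb R$ be symmetric ($A(-w)=A(w)$) with $\sum_{w\in\mathbb Z^\nu}|A(w)|e^{\varsigma\|w\|}\le a$ for some $\varsigma>0$. Let $\Theta$ be a metric space with a $\sigma$-algebra containing the open sets and a probability measure $\mathbb P$, and let $w\mapsto T^w$ be an action of $\mathbb Z^\nu$ on $\Theta$ by measurable maps which preserves $\mathbb P$ and is ergodic. Let $F:\Theta\to\mathbb R$ be Lipschitz with constant $L$ and $|F|\le B$, and for $\theta\in\Theta$ let $H_\theta$ be the operator on $\ell_2(\mathbb Z^\nu)$ given by $$(H_\theta\phi)(w)=\sum_{v\in\mathbb Z^\nu}A(w-v)\phi(v)+F(T^w\theta)\phi(w).$$ Put $P_{t,\theta}(w)=|e^{itH_\theta}(0,w)|^2$ and $P_t(w)=\sup_{\theta\in\Theta}P_{t,\theta}(w)$. For a finite $\Lambda\subset\mathbb Z^\nu$ with $0\in\Lambda$ let $H_{\theta,\Lambda}$ be the restriction of $H_\theta$ to $\Lambda$ (compression by the coordinate projection), let $G_{E,\Lambda,\theta}=(H_{\theta,\Lambda}-E)^{-1}$,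 and for $\epsilon>0$ let $\operatorname{Res}^*(\Lambda,\epsilon;\theta)$ be the set of all real $E$ outside the spectrum of $H_{\theta,\Lambda}$ for which there are $v\in\Lambda$ and $w\notin\Lambda$ with $|G_{E,\Lambda,\theta}(0,v)|>\epsilon$ and $|A(v-w)|>\epsilon$. Assume that, for some $k\ge0$, the metric probability space $\Theta$ has finite $k$-dimensional upper Minkowski content, bounded by $K$, in the sense that $$\sup_{\theta\in\Theta}\ \sup_{0<r\le1}\ \frac{r^k}{\mathbb P\{\theta':\operatorname{dist}(\theta,\theta')\le r\}}\le K<\infty ,$$ and that for some $\chi\ge1$ and some constant $D$ $$\operatorname{dist}(T^w\theta,T^w\theta')\le D(\|w\|+1)^\chi\operatorname{dist}(\theta,\theta')\qquad\text{for all } w\in\mathbb Z^\nu,\ \theta,\theta'\in\Theta .$$ Let $M\ge1$ be an integer, let $N\ge1$, let $\Lambda_1,\dots,\Lambda_M\subset[-N,N]^\nu\cap\mathbb Z^\nu$ each contain $0$, and let $0<\delta\le1$ be such that $$\forall E\in\mathbb R:\quad \mathbb P\Big\{\theta: E\in\bigcap_{m=1}^M\operatorname{Res}^*\big(\Lambda_m,\delta^{8(\nu+1)M};\theta\big)\Big\}\le\delta^{(2+\chi)k+1}.$$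 Then $$P_t(w)\le C\big[N^{2\nu}\delta+e^{-c\|w\|}\big]\qquad\text{whenever } \|w\|>N,\ 0\le t\le 1/\delta ,$$ where $c>0$ depends only on $\nu,\varsigma,a,B$, and $C>0$ depends only on $\nu,\varsigma,a,B,k,K,\chi,D,L$. -/

import Mathlib

open MeasureTheory
open scoped ENNReal NNReal

/-- The Hilbert space `ℓ₂(ℤ^ν)` of complex-valued functions. -/
abbrev LatticeL2 (ν : ℕ) : Type := lp (fun _ : Fin ν → ℤ => ℂ) 2

/-- Translation `φ ↦ φ(· - u)` is bounded on `ℓ₂(ℤ^ν)`. -/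
theorem exists_shift {ν : ℕ} (u : Fin ν → ℤ) :
    ∃ S : LatticeL2 ν →L[ℂ] LatticeL2 ν, ‖S‖ ≤ 1 ∧
      ∀ (φ : LatticeL2 ν) (w : Fin ν → ℤ), S φ w = φ (w - u) := by
  have h2 : 0 < (2 : ℝ≥0∞).toReal := by norm_num
  have hs : ∀ φ : LatticeL2 ν,
      Summable fun w => ‖φ (w - u)‖ ^ (2 : ℝ≥0∞).toReal := fun φ =>
    (Equiv.subRight u).summable_iff.mpr ((lp.memℓp φ).summable h2)
  let S₀ : LatticeL2 ν →ₗ[ℂ] LatticeL2 ν :=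
    { toFun := fun φ => ⟨fun w => φ (w - u), memℓp_gen (hs φ)⟩
      map_add' := fun φ ψ => by ext w; rfl
      map_smul' := fun c φ => by ext w; rfl }
  have hb : ∀ φ, ‖S₀ φ‖ ≤ 1 * ‖φ‖ := fun φ => by
    rw [one_mul]
    refine lp.norm_le_of_tsum_le h2 (norm_nonneg _) ?_
    rw [lp.norm_rpow_eq_tsum h2 φ]
    exact ((Equiv.subRight u).tsum_eq
      (fun w => ‖φ w‖ ^ (2 : ℝ≥0∞).toReal)).le
  exact ⟨S₀.mkContinuous 1 hb, S₀.mkContinuous_norm_le zero_le_one hb, fun φ w => rfl⟩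

/-- Multiplication by a bounded potential is bounded on `ℓ₂(ℤ^ν)`. -/
theorem exists_mulPotential {ν : ℕ} (V : (Fin ν → ℤ) → ℝ) (B : ℝ) (hV : ∀ w, |V w| ≤ B) :
    ∃ S : LatticeL2 ν →L[ℂ] LatticeL2 ν,
      ∀ (φ : LatticeL2 ν) (w : Fin ν → ℤ), S φ w = (V w : ℂ) * φ w := by
  have h2 : 0 < (2 : ℝ≥0∞).toReal := by norm_num
  have hB : 0 ≤ B := (abs_nonneg _).trans (hV 0)
  have hle : ∀ (φ : LatticeL2 ν) (w : Fin ν → ℤ),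
      ‖(V w : ℂ) * φ w‖ ^ (2 : ℝ≥0∞).toReal
        ≤ B ^ (2 : ℝ≥0∞).toReal * ‖φ w‖ ^ (2 : ℝ≥0∞).toReal := fun φ w => by
    rw [← Real.mul_rpow hB (norm_nonneg _), norm_mul, Complex.norm_real, Real.norm_eq_abs]
    exact Real.rpow_le_rpow (by positivity)
      (mul_le_mul_of_nonneg_right (hV w) (norm_nonneg _)) h2.le
  have hm : ∀ φ : LatticeL2 ν,
      Summable fun w => B ^ (2 : ℝ≥0∞).toReal * ‖φ w‖ ^ (2 : ℝ≥0∞).toReal := fun φ =>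
    ((lp.memℓp φ).summable h2).mul_left _
  have hs : ∀ φ : LatticeL2 ν,
      Summable fun w => ‖(V w : ℂ) * φ w‖ ^ (2 : ℝ≥0∞).toReal := fun φ =>
    Summable.of_nonneg_of_le (fun _ => by positivity) (hle φ) (hm φ)
  let S₀ : LatticeL2 ν →ₗ[ℂ] LatticeL2 ν :=
    { toFun := fun φ => ⟨fun w => (V w : ℂ) * φ w, memℓp_gen (hs φ)⟩
      map_add' := fun φ ψ => by ext w; exact mul_add _ _ _
      map_smul' := fun c φ => by ext w; exact mul_left_comm _ _ _ }
  have hb : ∀ φ, ‖S₀ φ‖ ≤ B * ‖φ‖ := fun φ => by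
    refine lp.norm_le_of_tsum_le h2 (by positivity) ?_
    rw [Real.mul_rpow hB (norm_nonneg _), lp.norm_rpow_eq_tsum h2 φ, ← tsum_mul_left]
    exact (hs φ).tsum_le_tsum (hle φ) (hm φ)
  exact ⟨S₀.mkContinuous B hb, fun φ w => rfl⟩

/-- For a summable kernel and a bounded potential the formula
`(H φ)(w) = ∑_v A(w - v) φ(v) + V(w) φ(w)` defines a bounded operator. -/
theorem exists_latticeOp {ν : ℕ} (A V : (Fin ν → ℤ) → ℝ)
    (hA : Summable fun w => |A w|) (B : ℝ) (hV : ∀ w, |V w| ≤ B) :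
    ∃ H : LatticeL2 ν →L[ℂ] LatticeL2 ν, ∀ (φ : LatticeL2 ν) (w : Fin ν → ℤ),
      H φ w = (∑' v, (A (w - v) : ℂ) * φ v) + (V w : ℂ) * φ w := by
  choose S hS1 hS using fun u : Fin ν → ℤ => exists_shift u
  obtain ⟨T, hT⟩ := exists_mulPotential V B hV
  have hsum : Summable fun u => (A u : ℂ) • S u := by
    refine Summable.of_norm_bounded hA fun u => ?_
    rw [norm_smul, Complex.norm_real, Real.norm_eq_abs]
    exact mul_le_of_le_one_right (abs_nonneg _) (hS1 u)
  refine ⟨(∑' u, (A u : ℂ) • S u) + T, fun φ w => ?_⟩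
  have h1 := (hsum.hasSum.mapL (ContinuousLinearMap.apply ℂ (LatticeL2 ν) φ)).mapL
    (lp.evalCLM ℂ (fun _ : Fin ν → ℤ => ℂ) 2 w)
  have h3 : (∑' v, (A (w - v) : ℂ) * φ v) = (∑' u, (A u : ℂ) • S u) φ w := by
    rw [← (Equiv.subLeft w).tsum_eq]
    refine (HasSum.tsum_eq ?_)
    have h2 : (fun u => (A (w - Equiv.subLeft w u) : ℂ) * φ (Equiv.subLeft w u)) = fun u =>
        lp.evalCLM ℂ (fun _ : Fin ν → ℤ => ℂ) 2 w
          (ContinuousLinearMap.apply ℂ (LatticeL2 ν) φ ((A u : ℂ) • S u)) := by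
      funext u
      have : (A u : ℂ) * φ (w - u) = ((A u : ℂ) • S u) φ w := by rw [← hS u φ w]; rfl
      rw [Equiv.subLeft_apply, sub_sub_cancel]; exact this
    rw [h2]
    exact h1
  rw [h3, ← hT]
  rfl

open Classical in
/-- The operator `H = A * · + V` on `ℓ₂(ℤ^ν)`, that is,
`(H φ)(w) = ∑_v A(w - v) φ(v) + V(w) φ(w)`. The defining formula determines it uniquely, and it
exists whenever `A` is summable and `V` is bounded (`latticeOp_apply`); otherwise the value is the
irrelevant `0` unless such a bounded operator happens to exist. -/
noncomputable def latticeOp {ν : ℕ} (A V : (Fin ν → ℤ) → ℝ) : LatticeL2 ν →L[ℂ] LatticeL2 ν :=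
  if h : ∃ H : LatticeL2 ν →L[ℂ] LatticeL2 ν, ∀ (φ : LatticeL2 ν) (w : Fin ν → ℤ),
      H φ w = (∑' v, (A (w - v) : ℂ) * φ v) + (V w : ℂ) * φ w
  then h.choose else 0

theorem latticeOp_apply {ν : ℕ} (A V : (Fin ν → ℤ) → ℝ)
    (hA : Summable fun w => |A w|) (B : ℝ) (hV : ∀ w, |V w| ≤ B)
    (φ : LatticeL2 ν) (w : Fin ν → ℤ) :
    latticeOp A V φ w = (∑' v, (A (w - v) : ℂ) * φ v) + (V w : ℂ) * φ w := by
  have h := exists_latticeOp A V hA B hV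
  rw [latticeOp, dif_pos h]
  exact h.choose_spec φ w

/-- The quantum transport probability `P_t(w) = |e^{itH}(0, w)|²`, where `H = A * · + V` and
`K(u, w) = (K δ_w)(u)` are the matrix elements of an operator `K` on `ℓ₂(ℤ^ν)`. -/
noncomputable def transportProb {ν : ℕ} (A V : (Fin ν → ℤ) → ℝ) (t : ℝ) (w : Fin ν → ℤ) : ℝ :=
  ‖(NormedSpace.exp ((Complex.I * (t : ℂ)) • latticeOp A V) :
      LatticeL2 ν →L[ℂ] LatticeL2 ν) (lp.single 2 w (1 : ℂ)) 0‖ ^ 2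

/-- The restriction `H_Λ` of `H = A * · + V` to a finite volume `Λ`, as a matrix indexed by `Λ`. -/
def restrictedOp {ν : ℕ} (A V : (Fin ν → ℤ) → ℝ) (Λ : Finset (Fin ν → ℤ)) :
    Matrix Λ Λ ℝ :=
  Matrix.of fun u v => A (u.1 - v.1) + if u = v then V u.1 else 0

/-- The matrix `H_Λ` consists of the matrix elements of `H` between sites of `Λ`. -/
theorem restrictedOp_eq {ν : ℕ} (A V : (Fin ν → ℤ) → ℝ)
    (hA : Summable fun w => |A w|) (B : ℝ) (hV : ∀ w, |V w| ≤ B)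
    (Λ : Finset (Fin ν → ℤ)) (u v : Λ) :
    ((restrictedOp A V Λ u v : ℝ) : ℂ) = latticeOp A V (lp.single 2 v.1 (1 : ℂ)) u.1 := by
  rw [latticeOp_apply A V hA B hV, tsum_eq_single v.1]
  · by_cases h : u = v
    · subst h; simp [restrictedOp]
    · have h' : u.1 ≠ v.1 := fun e => h (Subtype.ext e)
      simp [restrictedOp, h, h']
  · intro x hx
    simp [hx]

/-- The finite-volume Green function `G_{E,Λ}(u, v) = (H_Λ - E)⁻¹(u, v)` at a real energy `E`
outside the spectrum of `H_Λ`. -/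
noncomputable def greenFn {ν : ℕ} (A V : (Fin ν → ℤ) → ℝ) (Λ : Finset (Fin ν → ℤ)) (E : ℝ)
    (u v : Λ) : ℝ :=
  (restrictedOp A V Λ - E • (1 : Matrix Λ Λ ℝ))⁻¹ u v

/-- The set `Res*(Λ; ε)` of real energies `E` (outside the finite spectrum of `H_Λ`, so that the
Green function is defined) such that `|G_{E,Λ}(0, v)| > ε` and `|A(v - w)| > ε`
for some `v ∈ Λ` and `w ∉ Λ`. -/
def resStar {ν : ℕ} (A V : (Fin ν → ℤ) → ℝ) (Λ : Finset (Fin ν → ℤ)) (h0 : 0 ∈ Λ) (ε : ℝ) :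
    Set ℝ :=
  {E | IsUnit (restrictedOp A V Λ - E • (1 : Matrix Λ Λ ℝ)) ∧
    ∃ v : Λ, ∃ w : Fin ν → ℤ, w ∉ Λ ∧
      ε < |greenFn A V Λ E ⟨0, h0⟩ v| ∧ ε < |A (v.1 - w)|}

/-- The potential `V_θ(w) = F(T^w θ)` generated by a hull function `F` and an action
`T^w θ = w +ᵥ θ` of `ℤ^ν`. -/
def ergodicPotential {ν : ℕ} {Θ : Type*} [AddAction (Fin ν → ℤ) Θ] (F : Θ → ℝ) (θ : Θ) :
    (Fin ν → ℤ) → ℝ :=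
  fun w => F (w +ᵥ θ)

/-- The `k`-dimensional upper Minkowski content of a metric probability space `(Θ, P)`
(at scales at most `1`): the supremum of `r^k / P(B(θ, r))` over all points `θ` and
radii `0 < r ≤ 1`. Thus a content at most `K` means that `P(B(θ, r)) ≥ r^k / K` for all such
`θ` and `r`. -/
noncomputable def upperMinkowskiContent {Θ : Type*} [MetricSpace Θ] [MeasurableSpace Θ]
    (k : ℝ) (P : Measure Θ) : ℝ≥0∞ :=
  ⨆ (θ : Θ) (r : ℝ) (_ : r ∈ Set.Ioc (0 : ℝ) 1),
    ENNReal.ofReal (r ^ k) / P (Metric.closedBall θ r)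

/-! Write `e^{itH}` as a Cauchy integral of `(z - H)⁻¹` over the boundary of `[-R, R] × [-δ, R]`,
with `R = |a| + |B| + 1`. For `0 ≤ t ≤ 1/δ` the factor `e^{itz}` is at most `e` on the contour. On
three sides `|z| ≥ R`, and a weighted supremum argument gives decay `e^{-ς‖w‖}` of the resolvent
(`norm_resolvent_apply_le_exp`). It remains to show that on the bottom side the column `φ = (z -
H_θ)⁻¹ δ_w` satisfies `|φ(0)| ≲ N^ν √δ`; squaring then gives `N^{2ν} δ`.

Fix `z = x - iδ` and consider the harmonic measure on real energies seen from `z`, i.e. the uniform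
measure on the circle under a Möbius map. A ball of radius `δ^{2+χ}` about `θ` has probability at
least `δ^{(2+χ)k}/K`, more than the bad probability by a factor of order `1/δ`. By Fubini some `θ'`
in the ball has energies in all sets `Res*` only on at most half of the circle
(`exists_phase_mem_closedBall`). By pigeonhole a single `Λ_m` is non-resonant for `θ'` on a set of
harmonic measure at least `1/(2M)`.

The matrix elements of the finite-volume resolvent are, up to a factor 4, differences of Borel
transforms of positive measures. Normalised by Herglotz denominators they are bounded by 1 in the
lower half-plane, so the two-constants theorem carries smallness `ε` on the good energies to a bound
`ε^{1/(2M)} (1 + 4/δ)²` at `z` (`norm_borelTransform_sub_le`). With `ε = δ^{8(ν+1)M}` this beats all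
powers of `1/δ` which occur.

Finally `φ` restricted to `Λ_m` solves the finite-volume equation for `θ'`, with a right-hand side
made of the kernel leaving `Λ_m` and of the change of potential (`norm_resolvent_apply_zero_le`).
The first part meets a small Green function or a small kernel; the second is of order `δ² √δ` by the
choice of the radius and pays for two resolvents of size `1/δ`. -/

/-! ### Jensen's inequality and the two-constants theorem -/

/-- Jensen's inequality on the unit disc for a function which is analytic inside the disc, but may
have poles on the unit circle. -/
theorem log_norm_le_circleAverage {f : ℂ → ℂ}
    (hf : MeromorphicOn f (Metric.closedBall 0 1))
    (ha : AnalyticOnNhd ℂ f (Metric.ball 0 1)) (h0 : f 0 ≠ 0) :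
    Real.log ‖f 0‖ ≤ Real.circleAverage (fun ζ => Real.log ‖f ζ‖) 0 1 := by
  have hf' : MeromorphicOn f (Metric.closedBall 0 |(1 : ℝ)|) := by simpa using hf
  have ha0 : AnalyticAt ℂ f 0 := ha 0 (by simp)
  rw [hf'.circleAverage_log_norm one_ne_zero,
    ha0.meromorphicTrailingCoeffAt_of_ne_zero h0, Real.log_one, mul_zero, add_zero]
  -- In Jensen's formula zeros inside the disc contribute nonnegative terms; zeros and poles on the
  -- circle carry the factor `log 1 = 0`.
  refine le_add_of_nonneg_left (finsum_nonneg fun u => ?_)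
  rw [zero_sub, norm_neg, one_mul]
  by_cases hu : u ∈ Metric.closedBall (0 : ℂ) |(1 : ℝ)|
  · rcases lt_or_eq_of_le (show ‖u‖ ≤ 1 by simpa using hu) with h | h
    · refine mul_nonneg ?_ ?_
      · rw [MeromorphicOn.divisor_apply hf' hu]
        have := (ha u (by simpa using h)).meromorphicOrderAt_nonneg
        exact_mod_cast WithTop.untop₀_nonneg.2 this
      · rw [Real.log_inv, neg_nonneg]
        exact Real.log_nonpos (norm_nonneg _) h.le
    · simp [h]
  · simp [Function.locallyFinsuppWithin.apply_eq_zero_of_notMem _ hu]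

/-- The two-constants theorem on the unit disc: if `f` is bounded by `1` on the circle and by `ε` on
a subset `S`, then `‖f 0‖` is at most `ε` to the power of the harmonic measure of `S`. -/
theorem norm_zero_le_rpow {f : ℂ → ℂ}
    (hf : MeromorphicOn f (Metric.closedBall 0 1))
    (ha : AnalyticOnNhd ℂ f (Metric.ball 0 1)) {S : Set ℝ} (hS : MeasurableSet S)
    {ε : ℝ} (hε0 : 0 < ε)
    (h1 : ∀ᵐ α ∂(volume.restrict (Set.Ioc 0 (2 * Real.pi))), ‖f (circleMap 0 1 α)‖ ≤ 1)
    (hε : ∀ᵐ α ∂(volume.restrict (Set.Ioc 0 (2 * Real.pi))),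
      α ∈ S → ‖f (circleMap 0 1 α)‖ ≤ ε) :
    ‖f 0‖ ≤ ε ^ ((volume.restrict (Set.Ioc 0 (2 * Real.pi))).real S / (2 * Real.pi)) := by
  by_cases h0 : f 0 = 0
  · rw [h0, norm_zero]; positivity
  have hpi := Real.two_pi_pos
  have hle := log_norm_le_circleAverage hf ha h0
  have hord : ∀ u ∈ Metric.closedBall (0 : ℂ) 1, meromorphicOrderAt f u ≠ ⊤ := by
    have := (hf.exists_meromorphicOrderAt_ne_top_iff_forall
      ⟨Metric.nonempty_closedBall.mpr zero_le_one,
        (convex_closedBall (0 : ℂ) 1).isPreconnected⟩).1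
      ⟨⟨0, by simp⟩, by
        have ha0 : AnalyticAt ℂ f 0 := ha 0 (by simp)
        rw [ha0.meromorphicOrderAt_eq, ha0.analyticOrderAt_eq_zero.2 h0]
        simp⟩
    exact fun u hu => this ⟨u, hu⟩
  -- Zeros on the circle have to be discarded: there `Real.log 0 = 0` would exceed `log ε` when `ε <
  -- 1`.
  have hne : ∀ᵐ α ∂(volume.restrict (Set.Ioc 0 (2 * Real.pi))), f (circleMap 0 1 α) ≠ 0 := by
    refine ae_restrict_le_codiscreteWithin measurableSet_Ioc ?_
    have h2 := hf.eventually_codiscreteWithin_apply_ne_zero hord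
    have h3 := Filter.codiscreteWithin_mono
      (U₁ := Metric.sphere (0 : ℂ) |(1 : ℝ)|) (by simpa using Metric.sphere_subset_closedBall) h2
    exact Filter.codiscreteWithin_mono (Set.subset_univ _)
      (circleMap_preimage_codiscrete one_ne_zero h3)
  have hint : IntervalIntegrable (fun α => Real.log ‖f (circleMap 0 1 α)‖) volume 0
      (2 * Real.pi) := by
    have : MeromorphicOn f (Metric.sphere 0 |(1 : ℝ)|) :=
      fun u hu => hf u (by simpa using Metric.sphere_subset_closedBall hu)
    exact this.circleIntegrable_log_norm
  rw [intervalIntegrable_iff_integrableOn_Ioc_of_le hpi.le] at hint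
  have hint2 : Integrable (S.indicator fun _ => Real.log ε)
      (volume.restrict (Set.Ioc 0 (2 * Real.pi))) :=
    (integrable_const _).indicator hS
  have hI : ∫ α in (0 : ℝ)..(2 * Real.pi), Real.log ‖f (circleMap 0 1 α)‖
      ≤ (volume.restrict (Set.Ioc 0 (2 * Real.pi))).real S * Real.log ε := by
    have hc := integral_indicator_const (μ := volume.restrict (Set.Ioc 0 (2 * Real.pi)))
      (Real.log ε) hS
    rw [smul_eq_mul] at hc
    rw [intervalIntegral.integral_of_le hpi.le, ← hc]
    refine integral_mono_ae hint hint2 ?_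
    filter_upwards [h1, hε, hne] with α ha1 ha2 ha3
    by_cases hα : α ∈ S
    · rw [Set.indicator_of_mem hα]
      exact Real.log_le_log (norm_pos_iff.2 ha3) (ha2 hα)
    · rw [Set.indicator_of_notMem hα]
      exact Real.log_nonpos (norm_nonneg _) ha1
  rw [Real.circleAverage_def, smul_eq_mul] at hle
  rw [← Real.log_le_log_iff (norm_pos_iff.2 h0) (by positivity), Real.log_rpow hε0]
  refine hle.trans ?_
  rw [div_mul_eq_mul_div, div_eq_inv_mul]
  exact mul_le_mul_of_nonneg_left hI (by positivity)

/-! ### Harmonic measure of the lower half-plane -/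

/-- The Möbius map from the unit disc onto the lower half-plane which sends `0` to `x - iη`. -/
noncomputable def discToLowerHalfPlane (x η : ℝ) (ζ : ℂ) : ℂ :=
  x - Complex.I * η * ((1 + ζ) / (1 - ζ))

/-- The boundary point of the lower half-plane which corresponds to the angle `α`; the image of the
uniform measure is the harmonic measure seen from `x - iη`. -/
noncomputable def circleEnergy (x η α : ℝ) : ℝ :=
  (discToLowerHalfPlane x η (circleMap 0 1 α)).re

theorem discToLowerHalfPlane_zero (x η : ℝ) :
    discToLowerHalfPlane x η 0 = x - Complex.I * η := by
  simp [discToLowerHalfPlane]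

theorem discToLowerHalfPlane_im (x η : ℝ) (ζ : ℂ) :
    (discToLowerHalfPlane x η ζ).im = -(η * ((1 - ‖ζ‖ ^ 2) / ‖1 - ζ‖ ^ 2)) := by
  have h : ((1 + ζ) / (1 - ζ)).re = (1 - ‖ζ‖ ^ 2) / ‖1 - ζ‖ ^ 2 := by
    rw [Complex.div_re, ← add_div, ← Complex.normSq_eq_norm_sq, ← Complex.normSq_eq_norm_sq]
    congr 1
    simp [Complex.normSq_apply]
    ring
  simp [discToLowerHalfPlane, h]

theorem discToLowerHalfPlane_circleMap (x η α : ℝ) :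
    discToLowerHalfPlane x η (circleMap 0 1 α) = circleEnergy x η α := by
  apply Complex.ext
  · simp [circleEnergy]
  · rw [discToLowerHalfPlane_im]; simp

theorem measurable_circleEnergy (x η : ℝ) : Measurable (circleEnergy x η) := by
  have : Measurable (circleMap 0 1) := (continuous_circleMap 0 1).measurable
  unfold circleEnergy discToLowerHalfPlane
  fun_prop

/-- The Möbius map can be inverted explicitly, so apart from its pole at `1` only one point of the
circle has energy `E`; countable sets on the circle correspond to null sets of angles. -/
theorem measure_circleEnergy_eq {x η : ℝ} (hη : 0 < η) (E : ℝ) :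
    volume {α | circleEnergy x η α = E} = 0 := by
  have hsub : {α | circleEnergy x η α = E} ⊆ circleMap 0 1 ⁻¹'
      {1, (-(x - E) + Complex.I * η) / (-(x - E) - Complex.I * η)} := by
    intro α hα
    by_cases h1 : circleMap 0 1 α = 1
    · exact Or.inl h1
    right
    have h := discToLowerHalfPlane_circleMap x η α
    rw [show circleEnergy x η α = E from hα, discToLowerHalfPlane] at h
    have h2 : (1 : ℂ) - circleMap 0 1 α ≠ 0 := sub_ne_zero.2 (Ne.symm h1)
    have h3 : (-(x - E) - Complex.I * η : ℂ) ≠ 0 := fun h0 => by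
      have := congrArg Complex.im h0
      simp at this
      exact hη.ne' this
    rw [Set.mem_singleton_iff, eq_div_iff h3]
    field_simp at h
    linear_combination h
  have hc : ({1, (-(x - E) + Complex.I * η) / (-(x - E) - Complex.I * η)} : Set ℂ).Countable :=
    (Set.countable_singleton _).insert _
  exact measure_mono_null hsub ((hc.preimage_circleMap 0 one_ne_zero).measure_zero _)

/-! ### Borel transforms as Herglotz functions -/

section Herglotz

variable {ι : Type*} [Fintype ι]

/-- The Borel transform of the atomic measure with masses `p j` at the points `lam j`. -/
noncomputable def borelTransform (lam p : ι → ℝ) (z : ℂ) : ℂ :=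
  ∑ j, (p j : ℂ) / ((lam j : ℂ) - z)

theorem borelTransform_im_nonpos (lam p : ι → ℝ) (hp : ∀ j, 0 ≤ p j) {z : ℂ} (hz : z.im ≤ 0) :
    (borelTransform lam p z).im ≤ 0 := by
  rw [borelTransform, Complex.im_sum]
  refine Finset.sum_nonpos fun j _ => ?_
  rw [Complex.div_im]
  simp only [Complex.ofReal_im, Complex.sub_im, Complex.ofReal_re, zero_mul, zero_div, zero_sub,
    mul_neg, neg_div, neg_neg]
  exact div_nonpos_of_nonpos_of_nonneg (mul_nonpos_of_nonneg_of_nonpos (hp j) hz)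
    (Complex.normSq_nonneg _)

/-- The values lie in the closed lower half-plane, which has distance 1 from `i`. This provides
denominators without small values. -/
theorem one_le_norm_borelTransform_sub_I (lam p : ι → ℝ) (hp : ∀ j, 0 ≤ p j) {z : ℂ}
    (hz : z.im ≤ 0) : 1 ≤ ‖borelTransform lam p z - Complex.I‖ := by
  have h := borelTransform_im_nonpos lam p hp hz
  refine le_trans ?_ (Complex.abs_im_le_norm _)
  rw [Complex.sub_im, Complex.I_im, abs_of_nonpos (by linarith)]
  linarith

theorem norm_inv_ofReal_sub_le (E x η : ℝ) (hη : 0 < η) :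
    ‖((E : ℂ) - (x - Complex.I * η))⁻¹‖ ≤ 1 / η := by
  rw [norm_inv, one_div]
  refine inv_anti₀ hη ?_
  refine le_trans ?_ (Complex.abs_im_le_norm _)
  simp [abs_of_pos hη]

theorem norm_borelTransform_le (lam p : ι → ℝ) (hp : ∀ j, 0 ≤ p j) (x : ℝ) {η : ℝ} (hη : 0 < η) :
    ‖borelTransform lam p (x - Complex.I * η)‖ ≤ (∑ j, p j) / η := by
  rw [borelTransform, Finset.sum_div]
  refine (norm_sum_le _ _).trans (Finset.sum_le_sum fun j _ => ?_)
  rw [div_eq_mul_inv, norm_mul, Complex.norm_real, Real.norm_of_nonneg (hp j), div_eq_mul_one_div]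
  exact mul_le_mul_of_nonneg_left (norm_inv_ofReal_sub_le _ _ _ hη) (hp j)

theorem analyticAt_discToLowerHalfPlane (x η : ℝ) {ζ : ℂ} (hζ : ζ ≠ 1) :
    AnalyticAt ℂ (discToLowerHalfPlane x η) ζ := by
  have : (1 : ℂ) - ζ ≠ 0 := sub_ne_zero.2 (Ne.symm hζ)
  unfold discToLowerHalfPlane
  fun_prop (disch := assumption)

theorem meromorphicAt_discToLowerHalfPlane (x η : ℝ) (ζ : ℂ) :
    MeromorphicAt (discToLowerHalfPlane x η) ζ := by
  unfold discToLowerHalfPlane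
  fun_prop

/-- If the difference of two Borel transforms is small on a set of real energies, then it is small
at `x - iη`, with a rate given by the harmonic measure of this set. -/
theorem norm_borelTransform_sub_le (lam p q : ι → ℝ) (hp : ∀ j, 0 ≤ p j) (hq : ∀ j, 0 ≤ q j)
    (x : ℝ) {η : ℝ} (hη : 0 < η) {S : Set ℝ} (hS : MeasurableSet S)
    {ε : ℝ} (hε0 : 0 < ε)
    (hsmall : ∀ᵐ α ∂(volume.restrict (Set.Ioc 0 (2 * Real.pi))), α ∈ S →
      ‖borelTransform lam p (circleEnergy x η α) - borelTransform lam q (circleEnergy x η α)‖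
        ≤ 4 * ε) :
    ‖borelTransform lam p (x - Complex.I * η) - borelTransform lam q (x - Complex.I * η)‖
      ≤ 4 * ε ^ ((volume.restrict (Set.Ioc 0 (2 * Real.pi))).real S / (2 * Real.pi)) *
        ((1 + (∑ j, p j) / η) * (1 + (∑ j, q j) / η)) := by
  -- Borel transforms blow up at the atoms. Dividing by two factors of modulus at least 1 keeps
  -- smallness on `S` and yields a function bounded by 1; undoing the division at `x - iη` costs
  -- only the last factor of the claim. The bounds also hold for the default values at the atoms.
  set Φ : ℂ → ℂ := fun z => (borelTransform lam p z - borelTransform lam q z) / 4 /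
    ((borelTransform lam p z - Complex.I) * (borelTransform lam q z - Complex.I)) with hΦ
  have hlow : ∀ z : ℂ, z.im ≤ 0 →
      1 ≤ ‖(borelTransform lam p z - Complex.I) * (borelTransform lam q z - Complex.I)‖ := by
    intro z hz
    rw [norm_mul]
    exact one_le_mul_of_one_le_of_one_le (one_le_norm_borelTransform_sub_I lam p hp hz)
      (one_le_norm_borelTransform_sub_I lam q hq hz)
  have hΦ1 : ∀ z : ℂ, z.im ≤ 0 → ‖Φ z‖ ≤ 1 := by
    intro z hz
    have h1 := one_le_norm_borelTransform_sub_I lam p hp hz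
    have h2 := one_le_norm_borelTransform_sub_I lam q hq hz
    have h3 : ‖borelTransform lam p z - borelTransform lam q z‖ ≤
        ‖borelTransform lam p z - Complex.I‖ + ‖borelTransform lam q z - Complex.I‖ := by
      rw [← sub_sub_sub_cancel_right _ _ Complex.I]
      exact norm_sub_le _ _
    rw [hΦ, norm_div, norm_div, div_le_one (zero_lt_one.trans_le (hlow z hz)), norm_mul]
    rw [show ‖(4 : ℂ)‖ = 4 by simp]
    nlinarith
  have hΦε : ∀ z : ℂ, z.im ≤ 0 →
      ‖borelTransform lam p z - borelTransform lam q z‖ ≤ 4 * ε → ‖Φ z‖ ≤ ε := by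
    intro z hz h
    rw [hΦ, norm_div, norm_div, show ‖(4 : ℂ)‖ = 4 by simp,
      div_le_iff₀ (zero_lt_one.trans_le (hlow z hz))]
    have := hlow z hz
    nlinarith
  have hcirc : ∀ α, Φ (discToLowerHalfPlane x η (circleMap 0 1 α)) = Φ (circleEnergy x η α) :=
    fun α => by rw [discToLowerHalfPlane_circleMap]
  have hmer : MeromorphicOn (fun ζ => Φ (discToLowerHalfPlane x η ζ))
      (Metric.closedBall 0 1) := by
    intro ζ _
    have hd := meromorphicAt_discToLowerHalfPlane x η ζ
    have hb : ∀ r : ι → ℝ,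
        MeromorphicAt (fun ζ => borelTransform lam r (discToLowerHalfPlane x η ζ)) ζ := by
      intro r
      unfold borelTransform
      refine MeromorphicAt.fun_sum fun j _ => ?_
      fun_prop
    have hbp := hb p
    have hbq := hb q
    simp only [hΦ]
    fun_prop
  have han : AnalyticOnNhd ℂ (fun ζ => Φ (discToLowerHalfPlane x η ζ)) (Metric.ball 0 1) := by
    intro ζ hζ
    have hζ' : ‖ζ‖ < 1 := by simpa using hζ
    have hζ1 : ζ ≠ 1 := fun h => by rw [h, norm_one] at hζ'; exact lt_irrefl _ hζ'
    have hd := analyticAt_discToLowerHalfPlane x η hζ1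
    have him : (discToLowerHalfPlane x η ζ).im < 0 := by
      rw [discToLowerHalfPlane_im, neg_lt_zero]
      have h1 : 0 < ‖1 - ζ‖ := norm_pos_iff.2 (sub_ne_zero.2 (Ne.symm hζ1))
      have h2 : 0 < 1 - ‖ζ‖ ^ 2 := by nlinarith [norm_nonneg ζ]
      positivity
    have hb : ∀ r : ι → ℝ,
        AnalyticAt ℂ (fun ζ => borelTransform lam r (discToLowerHalfPlane x η ζ)) ζ := by
      intro r
      unfold borelTransform
      refine Finset.analyticAt_fun_sum _ fun j _ => ?_
      have : (lam j : ℂ) - discToLowerHalfPlane x η ζ ≠ 0 := fun h0 => by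
        have := congrArg Complex.im h0
        simp at this
        exact him.ne this
      fun_prop (disch := assumption)
    have hbp := hb p
    have hbq := hb q
    have hne := norm_pos_iff.1 (zero_lt_one.trans_le (hlow _ him.le))
    simp only [hΦ]
    exact ((hbp.sub hbq).div analyticAt_const (by norm_num)).div
      ((hbp.sub analyticAt_const).mul (hbq.sub analyticAt_const)) hne
  have key := norm_zero_le_rpow hmer han hS hε0
    (Filter.Eventually.of_forall fun α => by rw [hcirc]; exact hΦ1 _ (by simp))
    (by filter_upwards [hsmall] with α h hα
        rw [hcirc]; exact hΦε _ (by simp) (h hα))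
  rw [discToLowerHalfPlane_zero] at key
  set z : ℂ := x - Complex.I * η with hz
  have hzim : z.im ≤ 0 := by simp [hz, hη.le]
  have hD := hlow z hzim
  have hbd : ∀ r : ι → ℝ, (∀ j, 0 ≤ r j) →
      ‖borelTransform lam r z - Complex.I‖ ≤ 1 + (∑ j, r j) / η := fun r hr => by
    refine (norm_sub_le _ _).trans ?_
    rw [Complex.norm_I, add_comm]
    exact add_le_add_right (norm_borelTransform_le lam r hr x hη) 1
  have hrep : ‖borelTransform lam p z - borelTransform lam q z‖ = 4 * ‖Φ z‖ *
      ‖(borelTransform lam p z - Complex.I) * (borelTransform lam q z - Complex.I)‖ := by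
    rw [hΦ, norm_div, norm_div, show ‖(4 : ℂ)‖ = 4 by simp]
    field_simp
  rw [hrep, norm_mul (borelTransform lam p z - Complex.I)]
  have hp' := hbd p hp
  have hq' := hbd q hq
  have hp0 := (norm_nonneg _).trans hp'
  gcongr

end Herglotz

/-! ### Resolvents of real symmetric matrices -/

section Spectral

variable {n : Type*} [Fintype n] [DecidableEq n]

theorem exists_orthogonal_diagonalization {X : Matrix n n ℝ} (hX : X.IsSymm) :
    ∃ (U : Matrix n n ℝ) (lam : n → ℝ), U * U.transpose = 1 ∧ U.transpose * U = 1 ∧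
      X = U * Matrix.diagonal lam * U.transpose := by
  have hH : X.IsHermitian := by
    rw [Matrix.IsHermitian, Matrix.conjTranspose_eq_transpose_of_trivial]; exact hX
  refine ⟨hH.eigenvectorUnitary, hH.eigenvalues, ?_, ?_, ?_⟩
  · have := Unitary.coe_mul_star_self hH.eigenvectorUnitary
    rwa [Unitary.coe_star, Matrix.star_eq_conjTranspose,
      Matrix.conjTranspose_eq_transpose_of_trivial] at this
  · have := Unitary.coe_star_mul_self hH.eigenvectorUnitary
    rwa [Matrix.star_eq_conjTranspose, Matrix.conjTranspose_eq_transpose_of_trivial] at this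
  · have := hH.spectral_theorem
    rw [Unitary.conjStarAlgAut_apply] at this
    rwa [Matrix.star_eq_conjTranspose, Matrix.conjTranspose_eq_transpose_of_trivial] at this

theorem diagonalization_sub_smul {K : Type*} [Field K] {U X : Matrix n n K} {lam : n → K}
    (h1 : U * U.transpose = 1) (hX : X = U * Matrix.diagonal lam * U.transpose) (z : K) :
    X - z • (1 : Matrix n n K) = U * Matrix.diagonal (fun j => lam j - z) * U.transpose := by
  have hd : Matrix.diagonal (fun j => lam j - z) =
      Matrix.diagonal lam - z • (1 : Matrix n n K) := by
    rw [Matrix.smul_one_eq_diagonal, Matrix.diagonal_sub]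
  rw [hd, Matrix.mul_sub, Matrix.sub_mul, ← hX, Matrix.mul_smul, Matrix.mul_one, Matrix.smul_mul,
    h1]

theorem diagonalization_mul_inv {K : Type*} [Field K] {U : Matrix n n K} {d : n → K}
    (h1 : U * U.transpose = 1) (h2 : U.transpose * U = 1) (hd : ∀ j, d j ≠ 0) :
    (U * Matrix.diagonal d * U.transpose) * (U * Matrix.diagonal (fun j => (d j)⁻¹) * U.transpose)
      = 1 := by
  have h3 : Matrix.diagonal d * Matrix.diagonal (fun j => (d j)⁻¹) = (1 : Matrix n n K) := by
    rw [Matrix.diagonal_mul_diagonal, ← Matrix.diagonal_one]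
    congr 1
    funext j
    exact mul_inv_cancel₀ (hd j)
  calc _ = U * (Matrix.diagonal d * ((U.transpose * U) *
        Matrix.diagonal (fun j => (d j)⁻¹))) * U.transpose := by simp only [Matrix.mul_assoc]
    _ = 1 := by rw [h2, Matrix.one_mul, h3, Matrix.mul_one, h1]

theorem diagonalization_apply {K : Type*} [Field K] (U : Matrix n n K) (d : n → K) (x y : n) :
    (U * Matrix.diagonal d * U.transpose) x y = ∑ j, U x j * U y j * d j := by
  rw [Matrix.mul_apply]
  refine Finset.sum_congr rfl fun j _ => ?_
  rw [Matrix.mul_diagonal, Matrix.transpose_apply]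
  ring

/-- Off the spectrum, the matrix elements of the resolvent of a real symmetric matrix between two
basis vectors are differences of Borel transforms, and they represent the solutions of
`(X - z) φ = b`. -/
theorem exists_resolvent_representation {X : Matrix n n ℝ} (hX : X.IsSymm) :
    ∃ (lam : n → ℝ) (p q : n → n → n → ℝ),
      (∀ x y j, 0 ≤ p x y j) ∧ (∀ x y j, 0 ≤ q x y j) ∧
      (∀ x y, ∑ j, p x y j ≤ 4) ∧ (∀ x y, ∑ j, q x y j ≤ 4) ∧
      (∀ E : ℝ, (∀ j, lam j ≠ E) → IsUnit (X - E • (1 : Matrix n n ℝ)) ∧ ∀ x y,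
        borelTransform lam (p x y) E - borelTransform lam (q x y) E
          = 4 * (((X - E • (1 : Matrix n n ℝ))⁻¹ x y : ℝ) : ℂ)) ∧
      ∀ z : ℂ, (∀ j, (lam j : ℂ) ≠ z) → ∀ φ b : n → ℂ,
        (∀ x, (∑ y, (X x y : ℂ) * φ y) - z * φ x = b x) →
        ∀ x, φ x =
          ∑ y, (borelTransform lam (p x y) z - borelTransform lam (q x y) z) / 4 * b y := by
  obtain ⟨U, lam, h1, h2, hU⟩ := exists_orthogonal_diagonalization hX
  have hrow : ∀ x, ∑ j, U x j ^ 2 = 1 := fun x => by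
    have := congrFun (congrFun h1 x) x
    rw [Matrix.mul_apply, Matrix.one_apply_eq] at this
    rw [← this]
    exact Finset.sum_congr rfl fun j _ => by rw [Matrix.transpose_apply, sq]
  have hsum : ∀ x y (r : n → ℝ), (∀ j, r j ≤ 2 * (U x j ^ 2 + U y j ^ 2)) → ∑ j, r j ≤ 4 := by
    intro x y r hr
    calc ∑ j, r j ≤ ∑ j, 2 * (U x j ^ 2 + U y j ^ 2) := Finset.sum_le_sum fun j _ => hr j
      _ = 4 := by rw [← Finset.mul_sum, Finset.sum_add_distrib, hrow, hrow]; norm_num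
  have hbt : ∀ (z : ℂ) x y,
      borelTransform lam (fun j => (U x j + U y j) ^ 2) z
        - borelTransform lam (fun j => (U x j - U y j) ^ 2) z
        = 4 * ∑ j, (U x j : ℂ) * (U y j : ℂ) * ((lam j : ℂ) - z)⁻¹ := by
    intro z x y
    rw [borelTransform, borelTransform, ← Finset.sum_sub_distrib, Finset.mul_sum]
    refine Finset.sum_congr rfl fun j _ => ?_
    push_cast
    rw [div_eq_mul_inv, div_eq_mul_inv]
    ring
  -- Polarization: `(a + b)² - (a - b)² = 4ab` turns the signed spectral measure of two basis
  -- vectors into a difference of positive ones.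
  refine ⟨lam, fun x y j => (U x j + U y j) ^ 2, fun x y j => (U x j - U y j) ^ 2,
    fun _ _ _ => sq_nonneg _, fun _ _ _ => sq_nonneg _,
    fun x y => hsum x y _ fun j => by nlinarith [sq_nonneg (U x j - U y j)],
    fun x y => hsum x y _ fun j => by nlinarith [sq_nonneg (U x j + U y j)], ?_, ?_⟩
  · intro E hE
    have hinv := diagonalization_mul_inv h1 h2 (d := fun j => lam j - E)
      fun j => sub_ne_zero.2 (hE j)
    rw [← diagonalization_sub_smul h1 hU E] at hinv
    refine ⟨IsUnit.of_mul_eq_one _ hinv, fun x y => ?_⟩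
    rw [Matrix.inv_eq_right_inv hinv, hbt, diagonalization_apply]
    push_cast
    rfl
  · intro z hz φ b hφ x
    set UC : Matrix n n ℂ := U.map Complex.ofRealHom with hUC
    set XC : Matrix n n ℂ := X.map Complex.ofRealHom with hXC
    have h1C : UC * UC.transpose = 1 := by
      have := congrArg (fun Y : Matrix n n ℝ => Y.map Complex.ofRealHom) h1
      simpa [Matrix.map_mul, Matrix.transpose_map] using this
    have h2C : UC.transpose * UC = 1 := by
      have := congrArg (fun Y : Matrix n n ℝ => Y.map Complex.ofRealHom) h2
      simpa [Matrix.map_mul, Matrix.transpose_map] using this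
    have hUXC : XC = UC * Matrix.diagonal (fun j => (lam j : ℂ)) * UC.transpose := by
      have := congrArg (fun Y : Matrix n n ℝ => Y.map Complex.ofRealHom) hU
      simpa [Matrix.map_mul, Matrix.transpose_map, Matrix.diagonal_map] using this
    have hinv := mul_eq_one_comm.1 <| diagonalization_mul_inv h1C h2C
      (d := fun j => (lam j : ℂ) - z) fun j => sub_ne_zero.2 (hz j)
    rw [← diagonalization_sub_smul h1C hUXC z] at hinv
    have hb : (XC - z • (1 : Matrix n n ℂ)).mulVec φ = b := by
      funext y
      rw [Matrix.sub_mulVec, Matrix.smul_mulVec, Matrix.one_mulVec, ← hφ y]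
      rfl
    have : φ x =
        ((UC * Matrix.diagonal (fun j => ((lam j : ℂ) - z)⁻¹) * UC.transpose).mulVec b) x := by
      rw [← hb, Matrix.mulVec_mulVec, hinv, Matrix.one_mulVec]
    rw [this, Matrix.mulVec, dotProduct]
    refine Finset.sum_congr rfl fun y _ => ?_
    rw [diagonalization_apply, hbt]
    simp [hUC]

end Spectral

/-! ### Norm and self-adjointness of the lattice operator -/

section Operators

variable {ν : ℕ}

theorem norm_apply_le_norm (φ : LatticeL2 ν) (w : Fin ν → ℤ) : ‖φ w‖ ≤ ‖φ‖ :=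
  lp.norm_apply_le_norm two_ne_zero φ w

theorem norm_le_of_forall_norm_apply_le (S : LatticeL2 ν →L[ℂ] LatticeL2 ν) {b : ℝ} (hb : 0 ≤ b)
    (h : ∀ (φ : LatticeL2 ν) w, ‖S φ w‖ ≤ b * ‖φ w‖) : ‖S‖ ≤ b := by
  have h2 : 0 < (2 : ℝ≥0∞).toReal := by norm_num
  refine S.opNorm_le_bound hb fun φ => ?_
  refine lp.norm_le_of_tsum_le h2 (by positivity) ?_
  rw [Real.mul_rpow hb (norm_nonneg _), lp.norm_rpow_eq_tsum h2 φ, ← tsum_mul_left]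
  refine ((lp.memℓp (S φ)).summable h2).tsum_le_tsum (fun w => ?_)
    (((lp.memℓp φ).summable h2).mul_left _)
  rw [← Real.mul_rpow hb (norm_nonneg _)]
  exact Real.rpow_le_rpow (norm_nonneg _) (h φ w) h2.le

/-- The convolution is a superposition of translations, each of norm at most 1, with weights `A u`.
-/
theorem norm_latticeOp_le (A V : (Fin ν → ℤ) → ℝ) (hA : Summable fun w => |A w|) {B : ℝ}
    (hV : ∀ w, |V w| ≤ B) : ‖latticeOp A V‖ ≤ (∑' w, |A w|) + B := by
  choose S hS1 hS using fun u : Fin ν → ℤ => exists_shift u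
  obtain ⟨T, hT⟩ := exists_mulPotential V B hV
  have hB : 0 ≤ B := (abs_nonneg _).trans (hV 0)
  have hle : ∀ u, ‖(A u : ℂ) • S u‖ ≤ |A u| := fun u => by
    rw [norm_smul, Complex.norm_real, Real.norm_eq_abs]
    exact mul_le_of_le_one_right (abs_nonneg _) (hS1 u)
  have hsum : Summable fun u => (A u : ℂ) • S u := Summable.of_norm_bounded hA hle
  have heq : latticeOp A V = (∑' u, (A u : ℂ) • S u) + T := by
    ext φ w
    have h1 := (hsum.hasSum.mapL (ContinuousLinearMap.apply ℂ (LatticeL2 ν) φ)).mapL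
      (lp.evalCLM ℂ (fun _ : Fin ν → ℤ => ℂ) 2 w)
    rw [latticeOp_apply A V hA B hV, ← hT]
    change _ = (∑' u, (A u : ℂ) • S u) φ w + T φ w
    congr 1
    rw [← (Equiv.subLeft w).tsum_eq]
    refine HasSum.tsum_eq ?_
    refine h1.congr_fun fun u => ?_
    have : (A u : ℂ) * φ (w - u) = ((A u : ℂ) • S u) φ w := by rw [← hS u φ w]; rfl
    rw [Equiv.subLeft_apply, sub_sub_cancel]
    exact this
  rw [heq]
  refine (norm_add_le _ _).trans (add_le_add ?_ ?_)
  · exact tsum_of_norm_bounded hA.hasSum hle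
  · refine norm_le_of_forall_norm_apply_le T hB fun φ w => ?_
    rw [hT, norm_mul, Complex.norm_real, Real.norm_eq_abs]
    exact mul_le_mul_of_nonneg_right (hV w) (norm_nonneg _)

theorem latticeOp_single_apply (A V : (Fin ν → ℤ) → ℝ) (hA : Summable fun w => |A w|) {B : ℝ}
    (hV : ∀ w, |V w| ≤ B) (v w : Fin ν → ℤ) :
    latticeOp A V (lp.single 2 v (1 : ℂ)) w = ((A (w - v) + if w = v then V w else 0 : ℝ) : ℂ) := by
  rw [latticeOp_apply A V hA B hV, tsum_eq_single v]
  · by_cases h : w = v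
    · subst h; simp
    · simp [h]
  · intro x hx
    simp [hx]

/-- It suffices to compare the operator with its adjoint on the unit vectors, where this is the
symmetry of a real matrix; expansion in unit vectors and continuity do the rest. -/
theorem isSelfAdjoint_latticeOp (A V : (Fin ν → ℤ) → ℝ) (hsymm : ∀ w, A (-w) = A w)
    (hA : Summable fun w => |A w|) {B : ℝ} (hV : ∀ w, |V w| ≤ B) :
    IsSelfAdjoint (latticeOp A V) := by
  have key : ∀ v, star (latticeOp A V) (lp.single 2 v (1 : ℂ)) =
      latticeOp A V (lp.single 2 v (1 : ℂ)) := by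
    intro v
    ext w
    have h1 : star (latticeOp A V) (lp.single 2 v (1 : ℂ)) w
        = inner ℂ (lp.single 2 w (1 : ℂ)) (star (latticeOp A V) (lp.single 2 v (1 : ℂ))) := by
      rw [lp.inner_single_left]; simp
    rw [h1, ContinuousLinearMap.star_eq_adjoint, ContinuousLinearMap.adjoint_inner_right,
      lp.inner_single_right, latticeOp_single_apply A V hA hV, latticeOp_single_apply A V hA hV]
    rw [← hsymm (w - v), neg_sub]
    by_cases h : w = v
    · subst h; simp
    · simp [h, Ne.symm h]
  rw [IsSelfAdjoint]
  ext1 φ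
  have hφ := lp.hasSum_single (p := 2) (by norm_num) φ
  have h1 := hφ.mapL (star (latticeOp A V))
  have h2 := hφ.mapL (latticeOp A V)
  refine h1.unique ?_
  convert h2 using 2 with v
  have : (lp.single 2 v (φ v) : LatticeL2 ν) = (φ v) • lp.single 2 v (1 : ℂ) := by
    rw [← lp.single_smul]; simp
  rw [this, map_smul, map_smul, key v]

end Operators

/-! ### Cauchy's formula on a rectangle -/

section Contour

theorem Complex.log_sub_log_neg_of_im_pos {z : ℂ} (hz : 0 < z.im) :
    Complex.log z - Complex.log (-z) = Real.pi * Complex.I := by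
  rw [Complex.log, Complex.log, norm_neg, Complex.arg_neg_eq_arg_sub_pi_of_im_pos hz]
  push_cast
  ring

theorem integral_inv_eq_log_sub_log {γ : ℝ → ℂ} {u c : ℂ} (a b : ℝ)
    (hγ : ∀ s : ℝ, γ s = u * s + c) (h : ∀ s : ℝ, γ s ∈ Complex.slitPlane) :
    u * ∫ s in a..b, (γ s)⁻¹ = Complex.log (γ b) - Complex.log (γ a) := by
  have h1 : ∀ s, HasDerivAt γ u s := fun s => by
    rw [funext hγ]
    simpa using ((Complex.ofRealCLM.hasDerivAt (x := s)).const_mul u).add_const c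
  rw [← intervalIntegral.integral_const_mul]
  refine intervalIntegral.integral_eq_sub_of_hasDerivAt (f := fun s => Complex.log (γ s))
    (fun s _ => ?_) (Continuous.intervalIntegrable ?_ _ _)
  · rw [← div_eq_mul_inv]
    exact (h1 s).clog_real (h s)
  · have hc : Continuous γ := continuous_iff_continuousAt.2 fun s => (h1 s).continuousAt
    exact continuous_const.mul (hc.inv₀ fun s => Complex.slitPlane_ne_zero (h s))

/-- The integral of `f` along the boundary of the rectangle `[-R, R] × [-η, R]`. -/
noncomputable def rectIntegral (R η : ℝ) (f : ℂ → ℂ) : ℂ :=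
  (∫ x in (-R)..R, f (x + ((-η : ℝ) : ℂ) * Complex.I)) -
    (∫ x in (-R)..R, f (x + (R : ℂ) * Complex.I)) +
    Complex.I * (∫ y in (-η)..R, f ((R : ℂ) + y * Complex.I)) -
    Complex.I * (∫ y in (-η)..R, f (((-R : ℝ) : ℂ) + y * Complex.I))

theorem rectIntegral_inv_sub {R η lam : ℝ} (hη : 0 < η) (hlam : |lam| < R) :
    rectIntegral R η (fun z => (z - lam)⁻¹) = 2 * Real.pi * Complex.I := by
  obtain ⟨hl1, hl2⟩ := abs_lt.1 hlam
  have hR : 0 < R := (abs_nonneg _).trans_lt hlam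
  have hbot := integral_inv_eq_log_sub_log (u := 1) (c := -(η * Complex.I) - lam)
    (γ := fun x => (x : ℂ) + ((-η : ℝ) : ℂ) * Complex.I - lam) (-R) R
    (fun s => by push_cast; ring)
    (fun s => by rw [Complex.mem_slitPlane_iff]; right; simp [hη.ne'])
  have htop := integral_inv_eq_log_sub_log (u := 1) (c := R * Complex.I - lam)
    (γ := fun x => (x : ℂ) + (R : ℂ) * Complex.I - lam) (-R) R
    (fun s => by ring)
    (fun s => by rw [Complex.mem_slitPlane_iff]; right; simp [hR.ne'])
  have hright := integral_inv_eq_log_sub_log (u := Complex.I) (c := R - lam)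
    (γ := fun y => (R : ℂ) + y * Complex.I - lam) (-η) R
    (fun s => by ring)
    (fun s => by rw [Complex.mem_slitPlane_iff]; left; simp; linarith)
  -- The left side crosses the cut of the logarithm, so its negative is integrated instead. The
  -- change of branch at each of the two left corners contributes `πi`, together `2πi`.
  have hleft := integral_inv_eq_log_sub_log (u := -Complex.I) (c := R + lam)
    (γ := fun y => -(((-R : ℝ) : ℂ) + y * Complex.I - lam)) (-η) R
    (fun s => by push_cast; ring)
    (fun s => by rw [Complex.mem_slitPlane_iff]; left; simp; linarith)
  simp only [inv_neg, intervalIntegral.integral_neg, one_mul, neg_mul_neg] at hbot htop hright hleft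
  have h1 := Complex.log_sub_log_neg_of_im_pos (z := ((-R : ℝ) : ℂ) + R * Complex.I - lam)
    (by simpa using hR)
  have h2 := Complex.log_sub_log_neg_of_im_pos
    (z := -(((-R : ℝ) : ℂ) + ((-η : ℝ) : ℂ) * Complex.I - lam)) (by simpa using hη)
  rw [neg_neg] at h2
  rw [rectIntegral, hbot, htop, hright, hleft]
  linear_combination h1 + h2

/-- Cauchy's formula for `exp (itz)` and the boundary of the rectangle `[-R, R] × [-η, R]`. -/
theorem rectIntegral_exp_mul_inv_sub {R η lam : ℝ} (t : ℝ) (hη : 0 < η) (hlam : |lam| < R) :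
    rectIntegral R η (fun z => Complex.exp (Complex.I * t * z) * (z - lam)⁻¹) =
      2 * Real.pi * Complex.I * Complex.exp (Complex.I * t * lam) := by
  obtain ⟨hl1, hl2⟩ := abs_lt.1 hlam
  have hR : 0 < R := (abs_nonneg _).trans_lt hlam
  set e : ℂ → ℂ := fun z => Complex.exp (Complex.I * t * z) with he
  have hed : Differentiable ℂ e := by rw [he]; fun_prop
  have hg : Differentiable ℂ (dslope e lam) := fun z =>
    ((Complex.differentiableOn_dslope (s := Set.univ) Filter.univ_mem).2
      hed.differentiableOn).differentiableAt Filter.univ_mem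
  have hzero := Complex.integral_boundary_rect_eq_zero_of_differentiableOn (dslope e lam)
    ⟨-R, -η⟩ ⟨R, R⟩ hg.differentiableOn
  simp only [smul_eq_mul] at hzero
  -- The difference quotient `dslope e lam` is entire and integrates to zero, which reduces the
  -- claim to the integral of `(z - lam)⁻¹`.
  have hsplit : ∀ z : ℂ, z ≠ lam → e z * (z - lam)⁻¹ = dslope e lam z + e lam * (z - lam)⁻¹ := by
    intro z hz
    rw [dslope_of_ne _ hz, slope_def_field, div_eq_mul_inv]
    ring
  have hseg : ∀ (γ : ℝ → ℂ) (a b : ℝ), Continuous γ → (∀ s, γ s ≠ lam) →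
      ∫ s in a..b, e (γ s) * (γ s - lam)⁻¹ =
        (∫ s in a..b, dslope e lam (γ s)) + e lam * ∫ s in a..b, (γ s - lam)⁻¹ := by
    intro γ a b hγ hne
    rw [← intervalIntegral.integral_const_mul, ← intervalIntegral.integral_add]
    · exact intervalIntegral.integral_congr fun s _ => hsplit _ (hne s)
    · exact (hg.continuous.comp hγ).intervalIntegrable _ _
    · exact (continuous_const.mul ((hγ.sub continuous_const).inv₀
        fun s => sub_ne_zero.2 (hne s))).intervalIntegrable _ _
  have h1 := rectIntegral_inv_sub hη hlam
  rw [rectIntegral] at h1 ⊢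
  rw [hseg _ _ _ (by fun_prop), hseg _ _ _ (by fun_prop), hseg _ _ _ (by fun_prop),
    hseg _ _ _ (by fun_prop)]
  · linear_combination hzero + e lam * h1
  all_goals intro s hs
  · have := congrArg Complex.re hs; simp at this; linarith
  · have := congrArg Complex.re hs; simp at this; linarith
  · have := congrArg Complex.im hs; simp at this; linarith
  · have := congrArg Complex.im hs; simp at this; linarith

end Contour

/-! ### The unitary group through the resolvent -/

section FunctionalCalculus

/-- Puts all four sides of the rectangle on a common parameter interval, so that the contour
integral becomes a single operator-valued integral. -/
theorem intervalIntegral_eq_integral_unit (h : ℝ → ℂ) (a b : ℝ) :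
    ∫ x in a..b, h x = ∫ s in (0 : ℝ)..1, ((b - a : ℝ) : ℂ) * h (a + (b - a) * s) := by
  have := intervalIntegral.smul_integral_comp_add_mul (a := 0) (b := 1) h (b - a) a
  rw [intervalIntegral.integral_const_mul, ← Complex.real_smul, this]
  simp

variable {A : Type*} [CStarAlgebra A]

theorem IsSelfAdjoint.exists_ofReal_of_mem_spectrum {H : A} (hH : IsSelfAdjoint H) {lam : ℂ}
    (h : lam ∈ spectrum ℂ H) : ∃ r : ℝ, lam = r ∧ |r| ≤ ‖H‖ := by
  rcases subsingleton_or_nontrivial A with _ | _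
  · simp [spectrum.of_subsingleton] at h
  have hr := hH.mem_spectrum_eq_re h
  refine ⟨lam.re, hr, ?_⟩
  have := spectrum.norm_le_norm_of_mem h
  rwa [hr, Complex.norm_real, Real.norm_eq_abs] at this

theorem continuousOn_inv_sub_spectrum {H : A} {z : ℂ} (hz : ∀ lam ∈ spectrum ℂ H, z ≠ lam) :
    ContinuousOn (fun lam : ℂ => (z - lam)⁻¹) (spectrum ℂ H) :=
  ContinuousOn.inv₀ (by fun_prop) fun lam h => sub_ne_zero.2 (hz lam h)

theorem cfc_sub_add_sub (H : A) {f₁ f₂ f₃ f₄ : ℂ → ℂ} (h₁ : ContinuousOn f₁ (spectrum ℂ H))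
    (h₂ : ContinuousOn f₂ (spectrum ℂ H)) (h₃ : ContinuousOn f₃ (spectrum ℂ H))
    (h₄ : ContinuousOn f₄ (spectrum ℂ H)) :
    cfc (fun x => f₁ x - f₂ x + f₃ x - f₄ x) H = cfc f₁ H - cfc f₂ H + cfc f₃ H - cfc f₄ H := by
  rw [cfc_sub (fun x => f₁ x - f₂ x + f₃ x) f₄ H ((h₁.sub h₂).add h₃) h₄,
    cfc_add H (fun x => f₁ x - f₂ x) f₃ (h₁.sub h₂) h₃, cfc_sub f₁ f₂ H h₁ h₂]

theorem exp_I_smul_eq_cfc {H : A} (hH : IsSelfAdjoint H) (t : ℝ) :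
    NormedSpace.exp ((Complex.I * (t : ℂ)) • H) =
      cfc (fun lam : ℂ => Complex.exp (Complex.I * t * lam)) H := by
  have hn : IsStarNormal H := hH.isStarNormal
  have hn' : IsStarNormal ((Complex.I * (t : ℂ)) • H) := by
    rw [← cfc_const_mul_id (Complex.I * (t : ℂ)) H]; infer_instance
  rw [← CFC.complex_exp_eq_normedSpace_exp (p := IsStarNormal)]
  exact (cfc_comp_const_mul (Complex.I * (t : ℂ)) Complex.exp H
    Complex.continuous_exp.continuousOn).symm

theorem norm_exp_I_smul_le_one {H : A} (hH : IsSelfAdjoint H) (t : ℝ) :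
    ‖NormedSpace.exp ((Complex.I * (t : ℂ)) • H)‖ ≤ 1 := by
  rw [exp_I_smul_eq_cfc hH]
  refine norm_cfc_le zero_le_one fun lam hl => ?_
  obtain ⟨r, rfl, -⟩ := hH.exists_ofReal_of_mem_spectrum hl
  rw [Complex.norm_exp]
  simp

/-- The unitary group of a self-adjoint element as a contour integral of its resolvent along the
boundary of the rectangle `[-R, R] × [-η, R]`: an estimate for the matrix elements. -/
theorem norm_apply_exp_le {H : A} (hH : IsSelfAdjoint H) {R η t β₁ β₂ : ℝ} (hR : ‖H‖ < R)
    (hη : 0 < η) (ht : 0 ≤ t) (ℓ : A →L[ℂ] ℂ)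
    (h₁ : ∀ x : ℝ, |x| ≤ R →
      ‖ℓ (cfc (fun lam : ℂ => ((x : ℂ) - Complex.I * η - lam)⁻¹) H)‖ ≤ β₁)
    (h₂ : ∀ z : ℂ, R ≤ ‖z‖ → ‖ℓ (cfc (fun lam : ℂ => (z - lam)⁻¹) H)‖ ≤ β₂) :
    ‖ℓ (NormedSpace.exp ((Complex.I * (t : ℂ)) • H))‖
      ≤ Real.exp (t * η) * (2 * R * β₁ + (4 * R + 2 * η) * β₂) := by
  have hR0 : 0 < R := (norm_nonneg _).trans_lt hR
  have hn : IsStarNormal H := hH.isStarNormal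
  set e : ℂ → ℂ := fun z => Complex.exp (Complex.I * t * z) with he
  set r : ℂ → A := fun z => cfc (fun lam : ℂ => (z - lam)⁻¹) H with hr
  set g₁ : ℝ → ℂ := fun s => ((-R + (R - -R) * s : ℝ) : ℂ) + ((-η : ℝ) : ℂ) * Complex.I with hg₁
  set g₂ : ℝ → ℂ := fun s => ((-R + (R - -R) * s : ℝ) : ℂ) + (R : ℂ) * Complex.I with hg₂
  set g₃ : ℝ → ℂ := fun s => (R : ℂ) + ((-η + (R - -η) * s : ℝ) : ℂ) * Complex.I with hg₃
  set g₄ : ℝ → ℂ := fun s => ((-R : ℝ) : ℂ) + ((-η + (R - -η) * s : ℝ) : ℂ) * Complex.I with hg₄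
  have c₁ : Continuous g₁ := by fun_prop
  have c₂ : Continuous g₂ := by fun_prop
  have c₃ : Continuous g₃ := by fun_prop
  have c₄ : Continuous g₄ := by fun_prop
  have ce : Continuous e := by fun_prop
  set w₁ : ℂ := ((R - -R : ℝ) : ℂ) with hw₁
  set w₂ : ℂ := ((R - -η : ℝ) : ℂ) with hw₂
  have n₁ : ∀ s, ∀ lam ∈ spectrum ℂ H, g₁ s ≠ lam := by
    intro s lam hl h
    obtain ⟨q, rfl, hq⟩ := hH.exists_ofReal_of_mem_spectrum hl
    have := congrArg Complex.im h
    simp [hg₁] at this; linarith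
  have n₂ : ∀ s, ∀ lam ∈ spectrum ℂ H, g₂ s ≠ lam := by
    intro s lam hl h
    obtain ⟨q, rfl, hq⟩ := hH.exists_ofReal_of_mem_spectrum hl
    have := congrArg Complex.im h
    simp [hg₂] at this; linarith
  have n₃ : ∀ s, ∀ lam ∈ spectrum ℂ H, g₃ s ≠ lam := by
    intro s lam hl h
    obtain ⟨q, rfl, hq⟩ := hH.exists_ofReal_of_mem_spectrum hl
    have := congrArg Complex.re h
    simp [hg₃] at this
    have := (abs_lt.1 (hq.trans_lt hR)).2
    linarith
  have n₄ : ∀ s, ∀ lam ∈ spectrum ℂ H, g₄ s ≠ lam := by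
    intro s lam hl h
    obtain ⟨q, rfl, hq⟩ := hH.exists_ofReal_of_mem_spectrum hl
    have := congrArg Complex.re h
    simp [hg₄] at this
    have := (abs_lt.1 (hq.trans_lt hR)).1
    linarith
  set F : ℝ → ℂ → ℂ := fun s lam =>
    w₁ * e (g₁ s) * (g₁ s - lam)⁻¹ - w₁ * e (g₂ s) * (g₂ s - lam)⁻¹ +
      Complex.I * w₂ * e (g₃ s) * (g₃ s - lam)⁻¹ -
      Complex.I * w₂ * e (g₄ s) * (g₄ s - lam)⁻¹ with hF
  have hFint : ∀ lam ∈ spectrum ℂ H,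
      ∫ s in (0 : ℝ)..1, F s lam = 2 * Real.pi * Complex.I * e lam := by
    intro lam hl
    have hint : ∀ (g : ℝ → ℂ) (k : ℂ), Continuous g → (∀ s, ∀ lam ∈ spectrum ℂ H, g s ≠ lam) →
        IntervalIntegrable (fun s => k * e (g s) * (g s - lam)⁻¹) volume 0 1 := by
      intro g k hg hne
      exact ((continuous_const.mul (ce.comp hg)).mul ((hg.sub continuous_const).inv₀
        fun s => sub_ne_zero.2 (hne s lam hl))).intervalIntegrable _ _
    have i₁ := hint g₁ w₁ c₁ n₁
    have i₂ := hint g₂ w₁ c₂ n₂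
    have i₃ := hint g₃ (Complex.I * w₂) c₃ n₃
    have i₄ := hint g₄ (Complex.I * w₂) c₄ n₄
    obtain ⟨q, rfl, hq⟩ := hH.exists_ofReal_of_mem_spectrum hl
    rw [← rectIntegral_exp_mul_inv_sub t hη (hq.trans_lt hR), rectIntegral]
    simp only [hF]
    rw [intervalIntegral.integral_sub ((i₁.sub i₂).add i₃) i₄,
      intervalIntegral.integral_add (i₁.sub i₂) i₃, intervalIntegral.integral_sub i₁ i₂]
    rw [intervalIntegral_eq_integral_unit _ (-R) R, intervalIntegral_eq_integral_unit _ (-R) R,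
      intervalIntegral_eq_integral_unit _ (-η) R, intervalIntegral_eq_integral_unit _ (-η) R,
      ← intervalIntegral.integral_const_mul Complex.I,
      ← intervalIntegral.integral_const_mul Complex.I]
    simp only [mul_assoc, he, hg₁, hg₂, hg₃, hg₄, hw₁, hw₂]
  have hcontF : ContinuousOn (Function.uncurry F) (Set.univ ×ˢ spectrum ℂ H) := by
    have hc : ∀ (g : ℝ → ℂ) (k : ℂ), Continuous g → (∀ s, ∀ lam ∈ spectrum ℂ H, g s ≠ lam) →
        ContinuousOn (fun x : ℝ × ℂ => k * e (g x.1) * (g x.1 - x.2)⁻¹)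
          (Set.univ ×ˢ spectrum ℂ H) := by
      intro g k hg hne
      refine ContinuousOn.mul (by fun_prop) (ContinuousOn.inv₀ (by fun_prop) ?_)
      rintro ⟨s, lam⟩ ⟨_, hl⟩
      exact sub_ne_zero.2 (hne s lam hl)
    exact (((hc g₁ w₁ c₁ n₁).sub (hc g₂ w₁ c₂ n₂)).add (hc g₃ _ c₃ n₃)).sub (hc g₄ _ c₄ n₄)
  obtain ⟨K, hK⟩ := ((isCompact_Icc (a := (0 : ℝ)) (b := 1)).prod
    (spectrum.isCompact (𝕜 := ℂ) H)).exists_bound_of_continuousOn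
      (hcontF.mono (Set.prod_mono_left (Set.subset_univ _)))
  have hcfcF : ∀ s, cfc (F s) H = w₁ • e (g₁ s) • r (g₁ s) - w₁ • e (g₂ s) • r (g₂ s) +
      (Complex.I * w₂) • e (g₃ s) • r (g₃ s) - (Complex.I * w₂) • e (g₄ s) • r (g₄ s) := by
    intro s
    have d₁ := continuousOn_inv_sub_spectrum (n₁ s)
    have d₂ := continuousOn_inv_sub_spectrum (n₂ s)
    have d₃ := continuousOn_inv_sub_spectrum (n₃ s)
    have d₄ := continuousOn_inv_sub_spectrum (n₄ s)
    simp only [hF, hr, smul_smul]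
    rw [cfc_sub_add_sub H (d₁.const_mul _) (d₂.const_mul _) (d₃.const_mul _) (d₄.const_mul _),
      cfc_const_mul _ _ _ d₁, cfc_const_mul _ _ _ d₂, cfc_const_mul _ _ _ d₃,
      cfc_const_mul _ _ _ d₄]
  have hexp : NormedSpace.exp ((Complex.I * (t : ℂ)) • H) = cfc e H := exp_I_smul_eq_cfc hH t
  -- Cauchy's formula holds at each point of the spectrum, and the functional calculus commutes with
  -- the integral over the parameter, since the integrand is continuous and bounded on the spectrum.
  have hmain : (2 * Real.pi * Complex.I) • cfc e H = ∫ s in Set.Ioc (0 : ℝ) 1, cfc (F s) H := by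
    rw [← cfc_const_mul _ _ _ ce.continuousOn, ← cfc_setIntegral measurableSet_Ioc F (fun _ => K) H
      (hcontF.mono (Set.prod_mono_left (Set.subset_univ _)))]
    · refine cfc_congr fun lam hl => ?_
      rw [← hFint lam hl, intervalIntegral.integral_of_le zero_le_one]
    · refine ae_restrict_of_forall_mem measurableSet_Ioc fun s hs lam hl => ?_
      exact hK (s, lam) ⟨Set.Ioc_subset_Icc_self hs, hl⟩
    · exact (integrable_const K).hasFiniteIntegral
  have hintF : IntegrableOn (fun s => cfc (F s) H) (Set.Ioc (0 : ℝ) 1) := by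
    refine integrableOn_cfc measurableSet_Ioc F (fun _ => K) H
      (hcontF.mono (Set.prod_mono_left (Set.subset_univ _))) ?_
      (integrable_const K).hasFiniteIntegral
    refine ae_restrict_of_forall_mem measurableSet_Ioc fun s hs lam hl => ?_
    exact hK (s, lam) ⟨Set.Ioc_subset_Icc_self hs, hl⟩
  -- `|e^{itz}| = e^{-t Im z}`; this is where `t ≥ 0` enters.
  have hne : ∀ z : ℂ, -η ≤ z.im → ‖e z‖ ≤ Real.exp (t * η) := by
    intro z hz
    rw [he, Complex.norm_exp]
    refine Real.exp_le_exp.2 ?_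
    simp only [Complex.mul_re, Complex.I_re, Complex.ofReal_re, zero_mul, Complex.I_im,
      Complex.ofReal_im, mul_zero, sub_zero, Complex.mul_im, one_mul, zero_add, zero_sub]
    nlinarith
  have hβ₂ : 0 ≤ β₂ := (norm_nonneg _).trans (h₂ R (by simp [abs_of_pos hR0]))
  have hbd : ∀ s ∈ Set.Ioc (0 : ℝ) 1, ‖ℓ (cfc (F s) H)‖ ≤
      Real.exp (t * η) * (2 * R * β₁ + (4 * R + 2 * η) * β₂) := by
    intro s hs
    have hw₁n : ‖w₁‖ = 2 * R := by
      rw [hw₁, Complex.norm_real, Real.norm_of_nonneg (by linarith)]; ring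
    have hw₂n : ‖Complex.I * w₂‖ = R + η := by
      rw [norm_mul, Complex.norm_I, hw₂, Complex.norm_real, Real.norm_of_nonneg (by linarith)]; ring
    have hmul : ∀ (k z : ℂ) (β : ℝ), -η ≤ z.im → ‖ℓ (r z)‖ ≤ β →
        ‖ℓ (k • e z • r z)‖ ≤ ‖k‖ * (Real.exp (t * η) * β) := by
      intro k z β hz hβ
      rw [map_smul, map_smul, norm_smul, norm_smul]
      gcongr
      exact hne z hz
    have k₁ : ‖ℓ (r (g₁ s))‖ ≤ β₁ := by
      have := h₁ (-R + (R - -R) * s) (abs_le.2 ⟨by nlinarith [hs.1], by nlinarith [hs.2]⟩)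
      convert this using 5
      simp only [hg₁]
      push_cast
      ring
    have k₂ := h₂ (g₂ s)
      ((le_of_eq (by simp [hg₂, abs_of_pos hR0])).trans (Complex.abs_im_le_norm _))
    have k₃ := h₂ (g₃ s)
      ((le_of_eq (by simp [hg₃, abs_of_pos hR0])).trans (Complex.abs_re_le_norm _))
    have k₄ := h₂ (g₄ s)
      ((le_of_eq (by simp [hg₄, abs_of_pos hR0])).trans (Complex.abs_re_le_norm _))
    have y : 0 ≤ (R - -η) * s := mul_nonneg (by linarith) hs.1.le
    have m₁ := hmul w₁ (g₁ s) β₁ (by simp [hg₁]) k₁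
    have m₂ := hmul w₁ (g₂ s) β₂ (by simp [hg₂]; linarith) k₂
    have m₃ := hmul (Complex.I * w₂) (g₃ s) β₂ (by simp [hg₃]; linarith) k₃
    have m₄ := hmul (Complex.I * w₂) (g₄ s) β₂ (by simp [hg₄]; linarith) k₄
    rw [hw₁n] at m₁ m₂
    rw [hw₂n] at m₃ m₄
    rw [hcfcF s, map_sub, map_add, map_sub]
    refine (norm_sub_le _ _).trans ?_
    have := norm_add_le (ℓ (w₁ • e (g₁ s) • r (g₁ s)) - ℓ (w₁ • e (g₂ s) • r (g₂ s)))
      (ℓ ((Complex.I * w₂) • e (g₃ s) • r (g₃ s)))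
    have := norm_sub_le (ℓ (w₁ • e (g₁ s) • r (g₁ s))) (ℓ (w₁ • e (g₂ s) • r (g₂ s)))
    linarith
  have hfin : ‖ℓ ((2 * Real.pi * Complex.I) • cfc e H)‖ ≤
      Real.exp (t * η) * (2 * R * β₁ + (4 * R + 2 * η) * β₂) := by
    rw [hmain, ← ContinuousLinearMap.integral_comp_comm ℓ hintF]
    have := norm_setIntegral_le_of_norm_le_const (μ := volume) (s := Set.Ioc (0 : ℝ) 1)
      (f := fun s => ℓ (cfc (F s) H)) (by simp) hbd
    simpa using this
  rw [hexp]
  refine le_trans ?_ hfin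
  rw [map_smul, norm_smul]
  -- The factor `1/(2π)` of Cauchy's formula is dropped, as `2π ≥ 1`.
  refine le_mul_of_one_le_left (norm_nonneg _) ?_
  simp only [norm_mul, Complex.norm_I, Complex.norm_real, mul_one, Complex.norm_ofNat]
  rw [Real.norm_of_nonneg Real.pi_pos.le]
  linarith [Real.pi_gt_three]

end FunctionalCalculus

/-! ### The infinite-volume resolvent and its decay at large energies -/

section Resolvent

variable {ν : ℕ}

/-- With a unit vector for `ψ` this is the equation of a resolvent column, the form in which the
resolvent enters the estimates below. -/
theorem resolvent_apply_eq {H : LatticeL2 ν →L[ℂ] LatticeL2 ν} (hH : IsSelfAdjoint H) {z : ℂ}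
    (hz : ∀ lam ∈ spectrum ℂ H, z ≠ lam) (ψ : LatticeL2 ν) :
    z • cfc (fun lam : ℂ => (z - lam)⁻¹) H ψ - H (cfc (fun lam : ℂ => (z - lam)⁻¹) H ψ) = ψ := by
  have hn : IsStarNormal H := hH.isStarNormal
  have hc := continuousOn_inv_sub_spectrum hz
  have h1 : cfc (fun lam : ℂ => z - lam) H = z • 1 - H := by
    rw [cfc_sub (fun _ => z) (fun lam => lam) H, cfc_const z H, cfc_id' ℂ H,
      Algebra.algebraMap_eq_smul_one]
  have h2 : (z • 1 - H) * cfc (fun lam : ℂ => (z - lam)⁻¹) H = 1 := by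
    rw [← h1, ← cfc_mul (fun lam : ℂ => z - lam) (fun lam : ℂ => (z - lam)⁻¹) H (by fun_prop) hc,
      ← cfc_const_one ℂ H]
    exact cfc_congr fun lam hl => mul_inv_cancel₀ (sub_ne_zero.2 (hz lam hl))
  have h3 := congrArg (fun S : LatticeL2 ν →L[ℂ] LatticeL2 ν => S ψ) h2
  simpa using h3

theorem norm_resolvent_le {H : LatticeL2 ν →L[ℂ] LatticeL2 ν} (hH : IsSelfAdjoint H) (x : ℝ)
    {η : ℝ} (hη : 0 < η) :
    ‖cfc (fun lam : ℂ => ((x : ℂ) - Complex.I * η - lam)⁻¹) H‖ ≤ 1 / η := by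
  refine norm_cfc_le (by positivity) fun lam hl => ?_
  obtain ⟨r, rfl, -⟩ := hH.exists_ofReal_of_mem_spectrum hl
  rw [← norm_neg, ← inv_neg, neg_sub]
  exact norm_inv_ofReal_sub_le r x η hη

theorem summable_kernel_mul {A : (Fin ν → ℤ) → ℝ} (hA : Summable fun w => |A w|)
    (φ : LatticeL2 ν) (x : Fin ν → ℤ) : Summable fun v => (A (x - v) : ℂ) * φ v := by
  have h : Summable fun v => |A (x - v)| * ‖φ‖ :=
    ((Equiv.subLeft x).summable_iff.mpr hA).mul_right _
  refine Summable.of_norm_bounded h fun v => ?_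
  rw [norm_mul, Complex.norm_real, Real.norm_eq_abs]
  exact mul_le_mul_of_nonneg_left (norm_apply_le_norm φ v) (abs_nonneg _)

theorem summable_abs_of_summable_exp {A : (Fin ν → ℤ) → ℝ} {ς : ℝ} (hς : 0 < ς)
    (hA : Summable fun w => |A w| * Real.exp (ς * ‖w‖)) : Summable fun w => |A w| :=
  Summable.of_nonneg_of_le (fun _ => abs_nonneg _)
    (fun _ => le_mul_of_one_le_right (abs_nonneg _) (Real.one_le_exp (by positivity))) hA

theorem tsum_abs_le_tsum_exp {A : (Fin ν → ℤ) → ℝ} {ς : ℝ} (hς : 0 < ς)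
    (hA : Summable fun w => |A w| * Real.exp (ς * ‖w‖)) :
    ∑' w, |A w| ≤ ∑' w, |A w| * Real.exp (ς * ‖w‖) :=
  (summable_abs_of_summable_exp hς hA).tsum_le_tsum
    (fun _ => le_mul_of_one_le_right (abs_nonneg _) (Real.one_le_exp (by positivity))) hA

/-- Exponential decay of the resolvent at energies of large absolute value. -/
theorem norm_resolvent_apply_le_exp {A V : (Fin ν → ℤ) → ℝ} {ς a B : ℝ} (hς : 0 < ς)
    (hA : Summable fun w => |A w| * Real.exp (ς * ‖w‖))
    (ha : ∑' w, |A w| * Real.exp (ς * ‖w‖) ≤ a) (hV : ∀ w, |V w| ≤ B) {z : ℂ}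
    (hz : a + B + 1 ≤ ‖z‖) (w : Fin ν → ℤ) {φ : LatticeL2 ν}
    (hφ : z • φ - latticeOp A V φ = lp.single 2 w (1 : ℂ)) (x : Fin ν → ℤ) :
    ‖φ x‖ ≤ Real.exp (-(ς * ‖x - w‖)) := by
  have hA1 := summable_abs_of_summable_exp hς hA
  have hB : 0 ≤ B := (abs_nonneg _).trans (hV 0)
  have ha0 : 0 ≤ a := le_trans (tsum_nonneg fun _ => by positivity) ha
  set n : ℝ := ς * ‖x - w‖ with hn
  have hn0 : 0 ≤ n := by positivity
  -- The cap `n` keeps the weight bounded, so the weighted supremum of `φ` is finite before any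
  -- decay is known; at `x` the weight is still `e^n`.
  set W : (Fin ν → ℤ) → ℝ := fun y => Real.exp (min (ς * ‖y - w‖) n) with hW
  have hWpos : ∀ y, 0 < W y := fun y => Real.exp_pos _
  have hWw : W w = 1 := by simp [hW, hn0]
  have hWle : ∀ y v, W y ≤ Real.exp (ς * ‖y - v‖) * W v := by
    intro y v
    simp only [hW]
    rw [← Real.exp_add]
    refine Real.exp_le_exp.2 ?_
    have h1 : ‖y - w‖ ≤ ‖y - v‖ + ‖v - w‖ := norm_sub_le_norm_sub_add_norm_sub y v w
    rw [← min_add_add_left]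
    refine min_le_min ?_ (le_add_of_nonneg_left (by positivity))
    rw [← mul_add]
    exact mul_le_mul_of_nonneg_left h1 hς.le
  have hbdd : BddAbove (Set.range fun y => ‖φ y‖ * W y) := by
    refine ⟨‖φ‖ * Real.exp n, ?_⟩
    rintro _ ⟨y, rfl⟩
    exact mul_le_mul (norm_apply_le_norm φ y) (Real.exp_le_exp.2 (min_le_right _ _))
      (hWpos y).le (norm_nonneg _)
  set S : ℝ := ⨆ y, ‖φ y‖ * W y with hS
  have hSle : ∀ y, ‖φ y‖ * W y ≤ S := fun y => le_ciSup hbdd y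
  have hS0 : 0 ≤ S := le_trans (by positivity) (hSle 0)
  have hconv : ∀ y, ‖∑' v, (A (y - v) : ℂ) * φ v‖ * W y ≤ a * S := by
    intro y
    have h1 : Summable fun v => |A (y - v)| * Real.exp (ς * ‖y - v‖) :=
      (Equiv.subLeft y).summable_iff.mpr hA
    have h2 : ∑' v, |A (y - v)| * Real.exp (ς * ‖y - v‖) ≤ a := by
      refine le_trans (le_of_eq ?_) ha
      exact (Equiv.subLeft y).tsum_eq fun u => |A u| * Real.exp (ς * ‖u‖)
    have h3 : ‖∑' v, (A (y - v) : ℂ) * φ v‖ ≤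
        ∑' v, |A (y - v)| * Real.exp (ς * ‖y - v‖) * (S / W y) := by
      refine tsum_of_norm_bounded (h1.mul_right _).hasSum fun v => ?_
      rw [norm_mul, Complex.norm_real, Real.norm_eq_abs, mul_assoc]
      refine mul_le_mul_of_nonneg_left ?_ (abs_nonneg _)
      rw [mul_div_assoc', le_div_iff₀ (hWpos y)]
      calc ‖φ v‖ * W y ≤ ‖φ v‖ * (Real.exp (ς * ‖y - v‖) * W v) :=
            mul_le_mul_of_nonneg_left (hWle y v) (norm_nonneg _)
        _ = Real.exp (ς * ‖y - v‖) * (‖φ v‖ * W v) := by ring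
        _ ≤ _ := mul_le_mul_of_nonneg_left (hSle v) (Real.exp_pos _).le
    rw [tsum_mul_right] at h3
    calc _ ≤ (∑' v, |A (y - v)| * Real.exp (ς * ‖y - v‖)) * (S / W y) * W y :=
          mul_le_mul_of_nonneg_right h3 (hWpos y).le
      _ = (∑' v, |A (y - v)| * Real.exp (ς * ‖y - v‖)) * S := by
          rw [mul_assoc, div_mul_cancel₀ _ (hWpos y).ne']
      _ ≤ a * S := mul_le_mul_of_nonneg_right h2 hS0
  have hstep : ∀ y, ‖φ y‖ * W y * ‖z‖ ≤ 1 + (a + B) * S := by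
    intro y
    have h1 := congrArg (fun ψ : LatticeL2 ν => ψ y) hφ
    have h2 : z * φ y = lp.single (E := fun _ : Fin ν → ℤ => ℂ) 2 w (1 : ℂ) y
        + ((∑' v, (A (y - v) : ℂ) * φ v) + (V y : ℂ) * φ y) := by
      rw [← latticeOp_apply A V hA1 B hV]
      have h1' : z * φ y - latticeOp A V φ y =
          lp.single (E := fun _ : Fin ν → ℤ => ℂ) 2 w (1 : ℂ) y := h1
      rw [← h1']; ring
    have h3 : ‖lp.single (E := fun _ : Fin ν → ℤ => ℂ) 2 w (1 : ℂ) y‖ * W y ≤ 1 := by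
      by_cases h : y = w
      · subst h; simp [hWw]
      · simp [h]
    have h4 : ‖(V y : ℂ) * φ y‖ * W y ≤ B * S := by
      rw [norm_mul, Complex.norm_real, Real.norm_eq_abs, mul_assoc]
      exact mul_le_mul (hV y) (hSle y) (by positivity) hB
    calc ‖φ y‖ * W y * ‖z‖ = ‖z * φ y‖ * W y := by rw [norm_mul]; ring
      _ ≤ (‖lp.single (E := fun _ : Fin ν → ℤ => ℂ) 2 w (1 : ℂ) y‖ +
          (‖∑' v, (A (y - v) : ℂ) * φ v‖ + ‖(V y : ℂ) * φ y‖)) * W y := by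
          rw [h2]
          refine mul_le_mul_of_nonneg_right ?_ (hWpos y).le
          exact (norm_add_le _ _).trans (add_le_add_right (norm_add_le _ _) _)
      _ ≤ 1 + (a + B) * S := by nlinarith [hconv y]
  have hzpos : 0 < ‖z‖ := by linarith
  -- The equation bootstraps: `S ‖z‖ ≤ 1 + (a + B) S` and `‖z‖ ≥ a + B + 1` force `S ≤ 1`.
  have hS1 : S ≤ 1 := by
    have h1 : S ≤ (1 + (a + B) * S) / ‖z‖ :=
      ciSup_le fun y => (le_div_iff₀ hzpos).2 (hstep y)
    rw [le_div_iff₀ hzpos] at h1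
    nlinarith
  have hx := (hSle x).trans hS1
  have hWx : W x = Real.exp n := by simp [hW, hn]
  rw [hWx] at hx
  rw [Real.exp_neg, ← one_div, le_div_iff₀ (Real.exp_pos _)]
  exact hx

end Resolvent

/-! ### Comparison with a finite volume -/

section Local

variable {ν : ℕ}

theorem restrictedOp_isSymm (A V : (Fin ν → ℤ) → ℝ) (hsymm : ∀ w, A (-w) = A w)
    (Λ : Finset (Fin ν → ℤ)) : (restrictedOp A V Λ).IsSymm := by
  refine Matrix.IsSymm.ext fun u v => ?_
  simp only [restrictedOp, Matrix.of_apply]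
  rw [← hsymm (v.1 - u.1), neg_sub]
  by_cases h : u = v
  · subst h; rfl
  · simp [h, Ne.symm h]

/-- The part of a summable kernel where it is at most `ε` has a sum of order `√ε`. -/
theorem tsum_le_sqrt_mul {f A : (Fin ν → ℤ) → ℝ} {ε : ℝ}
    (hsqrt : Summable fun u => Real.sqrt |A u|) (hf0 : ∀ u, 0 ≤ f u)
    (hf : ∀ u, f u ≤ |A u|) (hfε : ∀ u, f u ≤ ε) :
    ∑' u, f u ≤ Real.sqrt ε * ∑' u, Real.sqrt |A u| := by
  rw [← tsum_mul_left]
  have h : ∀ u, f u ≤ Real.sqrt ε * Real.sqrt |A u| := fun u => by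
    rw [← Real.mul_self_sqrt (hf0 u)]
    exact mul_le_mul (Real.sqrt_le_sqrt (hfε u)) (Real.sqrt_le_sqrt (hf u)) (Real.sqrt_nonneg _)
      (Real.sqrt_nonneg _)
  exact (Summable.of_nonneg_of_le hf0 h (hsqrt.mul_left _)).tsum_le_tsum h (hsqrt.mul_left _)

/-- The resolvent of `A * · + V` between `0` and a site outside of `Λ` is estimated through the
finite volume `Λ` and a nearby potential `V'`, provided that the complement of
`Res*(Λ, ε)` for `V'` contains a set of given harmonic measure. -/
theorem norm_resolvent_apply_zero_le {A V V' : (Fin ν → ℤ) → ℝ} {a B ε κ η x : ℝ}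
    (hsymm : ∀ w, A (-w) = A w) (hA : Summable fun w => |A w|) (ha : ∑' w, |A w| ≤ a)
    (hsqrt : Summable fun u => Real.sqrt |A u|) (hV : ∀ w, |V w| ≤ B)
    {Λ : Finset (Fin ν → ℤ)} (h0 : 0 ∈ Λ) (hκ : ∀ v ∈ Λ, |V v - V' v| ≤ κ)
    {w : Fin ν → ℤ} (hw : w ∉ Λ) (hη : 0 < η) (hε : 0 < ε) {S : Set ℝ} (hS : MeasurableSet S)
    (hres : ∀ α ∈ S, circleEnergy x η α ∉ resStar A V' Λ h0 ε)
    {φ : LatticeL2 ν} (hφn : ‖φ‖ ≤ 1 / η)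
    (hφ : ((x : ℂ) - Complex.I * η) • φ - latticeOp A V φ = lp.single 2 w (1 : ℂ)) :
    ‖φ 0‖ ≤ Λ.card * (1 / η * (a * (ε ^ ((volume.restrict (Set.Ioc 0 (2 * Real.pi))).real S /
      (2 * Real.pi)) * (1 + 4 / η) ^ 2) + 2 / η * (Real.sqrt ε * ∑' u, Real.sqrt |A u|))
        + 2 / η * (κ * (1 / η))) := by
  set z : ℂ := (x : ℂ) - Complex.I * η with hz
  set om : ℝ := (volume.restrict (Set.Ioc 0 (2 * Real.pi))).real S / (2 * Real.pi) with hom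
  have ha0 : 0 ≤ a := (tsum_nonneg fun _ => abs_nonneg _).trans ha
  have hκ0 : 0 ≤ κ := (abs_nonneg _).trans (hκ 0 h0)
  have hQ : 0 ≤ ∑' u, Real.sqrt |A u| := tsum_nonneg fun _ => Real.sqrt_nonneg _
  obtain ⟨lam, p, q, hp, hq, hp4, hq4, hreal, hrep⟩ :=
    exists_resolvent_representation (restrictedOp_isSymm A V' hsymm Λ)
  set o : Λ := ⟨0, h0⟩ with ho
  set g : Λ → ℂ := fun v => (borelTransform lam (p o v) z - borelTransform lam (q o v) z) / 4
    with hg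
  -- The residual of `φ` in the finite-volume equation for `V'`. As `w ∉ Λ`, the source vanishes on
  -- `Λ`, so only the kernel leaving `Λ` and `V - V'` contribute.
  set b : Λ → ℂ := fun v =>
    (∑ y, (restrictedOp A V' Λ v y : ℂ) * φ y.1) - z * φ v.1 with hb
  have hφ0 : φ 0 = ∑ v, g v * b v := by
    refine hrep z (fun j h => ?_) (fun v => φ v.1) b (fun v => rfl) o
    have := congrArg Complex.im h
    simp [hz] at this
    exact hη.ne' this
  set T : Λ → ℝ := fun v => ∑' y, if y ∈ Λ then 0 else |A (v.1 - y)| with hT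
  have hsh : ∀ v : Λ, Summable fun y => |A (v.1 - y)| := fun v =>
    (Equiv.subLeft v.1).summable_iff.mpr hA
  have hTs : ∀ v : Λ, Summable fun y => if y ∈ Λ then 0 else |A (v.1 - y)| := fun v =>
    Summable.of_nonneg_of_le (fun y => by split_ifs <;> positivity)
      (fun y => by split_ifs <;> simp) (hsh v)
  have hTa : ∀ v, T v ≤ a := fun v => by
    refine ((hTs v).tsum_le_tsum (fun y => ?_) (hsh v)).trans ?_
    · split_ifs <;> simp
    · exact le_trans (le_of_eq ((Equiv.subLeft v.1).tsum_eq fun u => |A u|)) ha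
  have hT0 : ∀ v, 0 ≤ T v := fun v => tsum_nonneg fun y => by split_ifs <;> positivity
  have hbn : ∀ v, ‖b v‖ ≤ T v * (1 / η) + κ * (1 / η) := by
    intro v
    have hvw : v.1 ≠ w := fun h => hw (h ▸ v.2)
    have h1 := congrArg (fun ψ : LatticeL2 ν => ψ v.1) hφ
    have h1' : z * φ v.1 - latticeOp A V φ v.1 =
        lp.single (E := fun _ : Fin ν → ℤ => ℂ) 2 w (1 : ℂ) v.1 :=
      h1
    rw [latticeOp_apply A V hA B hV] at h1'
    have h2 : lp.single (E := fun _ : Fin ν → ℤ => ℂ) 2 w (1 : ℂ) v.1 = 0 := by simp [hvw]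
    rw [h2] at h1'
    have hs := summable_kernel_mul hA φ v.1
    have h3 : ∑' y, (A (v.1 - y) : ℂ) * φ y = (∑ y ∈ Λ, (A (v.1 - y) : ℂ) * φ y) +
        ∑' y, if y ∈ Λ then 0 else (A (v.1 - y) : ℂ) * φ y := by
      have h5 : ∑ y ∈ Λ, (A (v.1 - y) : ℂ) * φ y =
          ∑' y, if y ∈ Λ then (A (v.1 - y) : ℂ) * φ y else 0 := by
        rw [tsum_eq_sum (s := Λ) fun y hy => by simp [hy]]
        exact Finset.sum_congr rfl fun y hy => by simp [hy]
      rw [h5, ← Summable.tsum_add]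
      · exact tsum_congr fun y => by split_ifs <;> simp
      · exact summable_of_ne_finset_zero (s := Λ) fun y hy => by simp [hy]
      · refine Summable.of_norm_bounded hs.norm fun y => ?_
        split_ifs
        · rw [norm_zero]; exact norm_nonneg _
        · exact le_rfl
    have h4 : ∑ y, (restrictedOp A V' Λ v y : ℂ) * φ y.1 =
        (∑ y ∈ Λ, (A (v.1 - y) : ℂ) * φ y) + (V' v.1 : ℂ) * φ v.1 := by
      rw [← Finset.sum_coe_sort Λ fun y => (A (v.1 - y) : ℂ) * φ y]
      simp only [restrictedOp, Matrix.of_apply, Complex.ofReal_add, add_mul,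
        Finset.sum_add_distrib]
      congr 1
      rw [Finset.sum_eq_single v]
      · simp
      · intro y _ hy; simp [Ne.symm hy]
      · simp
    have h6 : b v = -(∑' y, if y ∈ Λ then 0 else (A (v.1 - y) : ℂ) * φ y)
        - ((V v.1 - V' v.1 : ℝ) : ℂ) * φ v.1 := by
      simp only [hb]
      rw [h4]
      rw [h3] at h1'
      push_cast
      linear_combination -h1'
    have h7 : ‖∑' y, if y ∈ Λ then 0 else (A (v.1 - y) : ℂ) * φ y‖ ≤ T v * (1 / η) := by
      simp only [hT]
      rw [← tsum_mul_right]
      refine tsum_of_norm_bounded ((hTs v).mul_right _).hasSum fun y => ?_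
      split_ifs
      · simp
      · rw [norm_mul, Complex.norm_real, Real.norm_eq_abs]
        exact mul_le_mul_of_nonneg_left ((norm_apply_le_norm φ y).trans hφn) (abs_nonneg _)
    rw [h6]
    refine (norm_sub_le _ _).trans (add_le_add (by rwa [norm_neg]) ?_)
    rw [norm_mul, Complex.norm_real, Real.norm_eq_abs]
    exact mul_le_mul (hκ v.1 v.2) ((norm_apply_le_norm φ _).trans hφn) (norm_nonneg _) hκ0
  have hg2 : ∀ v, ‖g v‖ ≤ 2 / η := by
    intro v
    have h1 := norm_borelTransform_le lam (p o v) (hp o v) x hη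
    have h2 := norm_borelTransform_le lam (q o v) (hq o v) x hη
    have h3 : (∑ j, p o v j) / η ≤ 4 / η := by gcongr; exact hp4 o v
    have h4 : (∑ j, q o v j) / η ≤ 4 / η := by gcongr; exact hq4 o v
    simp only [hg]
    rw [norm_div, show ‖(4 : ℂ)‖ = 4 by simp, div_le_iff₀ (by norm_num)]
    refine (norm_sub_le _ _).trans ?_
    calc _ ≤ 4 / η + 4 / η := add_le_add (h1.trans h3) (h2.trans h4)
      _ = _ := by ring
  -- At sites with a kernel entry larger than `ε` to the outside, non-resonance bounds the Green
  -- function by `ε` on `S`, and the two-constants theorem applies.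
  have hac : ∀ v : Λ, (∃ y, y ∉ Λ ∧ ε < |A (v.1 - y)|) →
      ‖g v‖ ≤ ε ^ om * (1 + 4 / η) ^ 2 := by
    rintro v ⟨y, hy, hAy⟩
    have hsm : ∀ᵐ α ∂(volume.restrict (Set.Ioc 0 (2 * Real.pi))), α ∈ S →
        ‖borelTransform lam (p o v) (circleEnergy x η α)
          - borelTransform lam (q o v) (circleEnergy x η α)‖ ≤ 4 * ε := by
      -- `resStar` contains no eigenvalues, so avoiding it says nothing about the Green function
      -- there; their angles form a null set.
      have hnull : ∀ᵐ α ∂(volume.restrict (Set.Ioc 0 (2 * Real.pi))),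
          ∀ j, circleEnergy x η α ≠ lam j := by
        rw [ae_all_iff]
        intro j
        exact ae_restrict_of_ae (measure_eq_zero_iff_ae_notMem.1 (measure_circleEnergy_eq hη _))
      filter_upwards [hnull] with α hα hαS
      obtain ⟨hu, hG⟩ := hreal (circleEnergy x η α) fun j => (hα j).symm
      rw [hG o v, norm_mul, Complex.norm_real, show ‖(4 : ℂ)‖ = 4 by simp]
      refine mul_le_mul_of_nonneg_left ?_ (by norm_num)
      by_contra! hcon
      exact hres α hαS ⟨hu, v, y, hy, hcon, hAy⟩
    have h1 := norm_borelTransform_sub_le lam (p o v) (q o v) (hp o v) (hq o v) x hη hS hε hsm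
    have h3 : (∑ j, p o v j) / η ≤ 4 / η := by gcongr; exact hp4 o v
    have h4 : (∑ j, q o v j) / η ≤ 4 / η := by gcongr; exact hq4 o v
    have h5 : 0 ≤ (∑ j, q o v j) / η := by
      have := Finset.sum_nonneg fun j (_ : j ∈ Finset.univ) => hq o v j
      positivity
    simp only [hg]
    rw [norm_div, show ‖(4 : ℂ)‖ = 4 by simp, div_le_iff₀ (by norm_num)]
    calc _ ≤ 4 * ε ^ om * ((1 + (∑ j, p o v j) / η) * (1 + (∑ j, q o v j) / η)) := h1
      _ ≤ 4 * ε ^ om * ((1 + 4 / η) * (1 + 4 / η)) := by gcongr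
      _ = _ := by ring
  -- At the remaining sites the Green function has only the trivial bound `2/η`, but every kernel
  -- entry to the outside is at most `ε`.
  have hin : ∀ v : Λ, (¬ ∃ y, y ∉ Λ ∧ ε < |A (v.1 - y)|) →
      T v ≤ Real.sqrt ε * ∑' u, Real.sqrt |A u| := by
    intro v hv
    push Not at hv
    have h1 := tsum_le_sqrt_mul (f := fun y => if y ∈ Λ then 0 else |A (v.1 - y)|)
      (A := fun y => A (v.1 - y)) (ε := ε) ((Equiv.subLeft v.1).summable_iff.mpr hsqrt)
      (fun y => by split_ifs <;> positivity) (fun y => by split_ifs <;> simp)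
      (fun y => by split_ifs with h; exacts [hε.le, hv y h])
    have h2 : ∑' y, Real.sqrt |A (v.1 - y)| = ∑' u, Real.sqrt |A u| :=
      (Equiv.subLeft v.1).tsum_eq fun u => Real.sqrt |A u|
    rwa [h2] at h1
  have hterm : ∀ v : Λ, ‖g v * b v‖ ≤ 1 / η * (a * (ε ^ om * (1 + 4 / η) ^ 2) +
      2 / η * (Real.sqrt ε * ∑' u, Real.sqrt |A u|)) + 2 / η * (κ * (1 / η)) := by
    intro v
    have hom0 : 0 ≤ ε ^ om * (1 + 4 / η) ^ 2 := by positivity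
    have hgT : ‖g v‖ * T v ≤ a * (ε ^ om * (1 + 4 / η) ^ 2) +
        2 / η * (Real.sqrt ε * ∑' u, Real.sqrt |A u|) := by
      by_cases hv : ∃ y, y ∉ Λ ∧ ε < |A (v.1 - y)|
      · refine le_trans ?_ (le_add_of_nonneg_right (by positivity))
        rw [mul_comm a]
        exact mul_le_mul (hac v hv) (hTa v) (hT0 v) hom0
      · refine le_trans ?_ (le_add_of_nonneg_left (by positivity))
        exact mul_le_mul (hg2 v) (hin v hv) (hT0 v) (by positivity)
    calc ‖g v * b v‖ = ‖g v‖ * ‖b v‖ := norm_mul _ _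
      _ ≤ ‖g v‖ * (T v * (1 / η) + κ * (1 / η)) :=
          mul_le_mul_of_nonneg_left (hbn v) (norm_nonneg _)
      _ = 1 / η * (‖g v‖ * T v) + ‖g v‖ * (κ * (1 / η)) := by ring
      _ ≤ _ := add_le_add (mul_le_mul_of_nonneg_left hgT (by positivity))
          (mul_le_mul_of_nonneg_right (hg2 v) (by positivity))
  rw [hφ0]
  refine (norm_sum_le _ _).trans ((Finset.sum_le_sum fun v _ => hterm v).trans (le_of_eq ?_))
  rw [Finset.sum_const, Finset.card_univ, Fintype.card_coe, nsmul_eq_mul]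

end Local

/-! ### Lattice sums and counting -/

section Summability

theorem summable_exp_neg_mul_norm_int {s : ℝ} (hs : 0 < s) :
    Summable fun n : ℤ => Real.exp (-(s * ‖n‖)) := by
  have h : Summable fun n : ℕ => Real.exp (-(s * n)) := by
    have := Real.summable_exp_nat_mul_of_ge (c := -s) (by linarith) (f := fun n => (n : ℝ))
      fun n => le_rfl
    simpa using this
  refine Summable.of_nat_of_neg ?_ ?_ <;> simpa using h

theorem summable_prod_pi {ι α : Type*} [Fintype ι] {f : α → ℝ} (hf0 : ∀ n, 0 ≤ f n)
    (hf : Summable f) : Summable fun u : ι → α => ∏ i, f (u i) := by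
  classical
  refine summable_of_sum_le (c := (∑' n, f n) ^ Fintype.card ι)
    (fun u => Finset.prod_nonneg fun i _ => hf0 _) fun s => ?_
  calc ∑ u ∈ s, ∏ i, f (u i)
      ≤ ∑ u ∈ Fintype.piFinset fun i => s.image fun u => u i, ∏ i, f (u i) := by
        refine Finset.sum_le_sum_of_subset_of_nonneg (fun u hu => ?_)
          fun _ _ _ => Finset.prod_nonneg fun i _ => hf0 _
        rw [Fintype.mem_piFinset]
        exact fun i => Finset.mem_image_of_mem (fun u => u i) hu
    _ = ∏ i, ∑ n ∈ s.image fun u => u i, f n :=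
        (Finset.prod_univ_sum (fun i => s.image fun u : ι → α => u i) fun _ n => f n).symm
    _ ≤ ∏ _i : ι, ∑' n, f n :=
        Finset.prod_le_prod (fun i _ => Finset.sum_nonneg fun n _ => hf0 n)
          fun i _ => hf.sum_le_tsum _ fun n _ => hf0 n
    _ = _ := by rw [Finset.prod_const, Finset.card_univ]

/-- The max-norm dominates averages of the coordinates, so a product of one-dimensional exponentials
is a majorant. The rate `s / (ν + 1)` also covers `ν = 0`. -/
theorem summable_exp_neg_mul_norm {ν : ℕ} {s : ℝ} (hs : 0 < s) :
    Summable fun u : Fin ν → ℤ => Real.exp (-(s * ‖u‖)) := by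
  have h := summable_prod_pi (ι := Fin ν) (fun n => (Real.exp_pos _).le)
    (summable_exp_neg_mul_norm_int (s := s / (ν + 1)) (by positivity))
  refine Summable.of_nonneg_of_le (fun _ => (Real.exp_pos _).le) (fun u => ?_) h
  rw [← Real.exp_sum]
  refine Real.exp_le_exp.2 ?_
  rw [Finset.sum_neg_distrib, neg_le_neg_iff, ← Finset.mul_sum]
  calc s / (ν + 1) * ∑ i, ‖u i‖ ≤ s / (ν + 1) * ∑ _i : Fin ν, ‖u‖ := by
        gcongr with i; exact norm_le_pi_norm u i
    _ = s * ‖u‖ * (ν / (ν + 1)) := by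
        rw [Finset.sum_const, Finset.card_univ, Fintype.card_fin, nsmul_eq_mul]; ring
    _ ≤ s * ‖u‖ := by
        refine mul_le_of_le_one_right (by positivity) ?_
        rw [div_le_one (by positivity)]; linarith

/-- Arithmetic-geometric mean for `√|x| e^{sn/2}` and `e^{-sn/2}`. It bounds `∑ √|A|` in terms of
`ν`, `ς` and `a` alone. -/
theorem sqrt_abs_le_add {x s n : ℝ} :
    Real.sqrt |x| ≤ |x| * Real.exp (s * n) + Real.exp (-(s * n)) := by
  have h1 : Real.sqrt |x| ^ 2 = |x| := Real.sq_sqrt (abs_nonneg x)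
  have h2 : Real.exp (s * n / 2) * Real.exp (-(s * n / 2)) = 1 := by
    rw [← Real.exp_add]; simp
  have h3 : Real.exp (s * n) = Real.exp (s * n / 2) ^ 2 := by
    rw [← Real.exp_nat_mul]; congr 1; push_cast; ring
  have h4 : Real.exp (-(s * n)) = Real.exp (-(s * n / 2)) ^ 2 := by
    rw [← Real.exp_nat_mul]; congr 1; push_cast; ring
  rw [h3, h4]
  nth_rewrite 2 [← h1]
  nlinarith [sq_nonneg (Real.sqrt |x| * Real.exp (s * n / 2) - Real.exp (-(s * n / 2))),
    Real.sqrt_nonneg |x|]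

variable {ν : ℕ} {A : (Fin ν → ℤ) → ℝ} {ς : ℝ}

theorem summable_sqrt_abs (hς : 0 < ς) (hA : Summable fun w => |A w| * Real.exp (ς * ‖w‖)) :
    Summable fun u => Real.sqrt |A u| :=
  Summable.of_nonneg_of_le (fun _ => Real.sqrt_nonneg _) (fun _ => sqrt_abs_le_add)
    (hA.add (summable_exp_neg_mul_norm hς))

theorem tsum_sqrt_abs_le (hς : 0 < ς) (hA : Summable fun w => |A w| * Real.exp (ς * ‖w‖)) :
    ∑' u, Real.sqrt |A u| ≤
      (∑' u, |A u| * Real.exp (ς * ‖u‖)) + ∑' u : Fin ν → ℤ, Real.exp (-(ς * ‖u‖)) := by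
  rw [← Summable.tsum_add hA (summable_exp_neg_mul_norm hς)]
  exact (summable_sqrt_abs hς hA).tsum_le_tsum (fun _ => sqrt_abs_le_add)
    (hA.add (summable_exp_neg_mul_norm hς))

theorem card_le_of_norm_le {Λ : Finset (Fin ν → ℤ)} {N : ℝ} (hN : 1 ≤ N)
    (hΛ : ∀ w ∈ Λ, ‖w‖ ≤ N) : (Λ.card : ℝ) ≤ 3 ^ ν * N ^ ν := by
  have hsub : Λ ⊆ Fintype.piFinset fun _ : Fin ν => Finset.Icc (-(⌊N⌋ : ℤ)) ⌊N⌋ := by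
    intro w hw
    rw [Fintype.mem_piFinset]
    intro i
    have h1 : ‖w i‖ ≤ N := (norm_le_pi_norm w i).trans (hΛ w hw)
    rw [Int.norm_eq_abs] at h1
    rw [Finset.mem_Icc, ← abs_le, Int.le_floor]
    exact_mod_cast h1
  have h2 : (Λ.card : ℝ) ≤ ((Finset.Icc (-(⌊N⌋ : ℤ)) ⌊N⌋).card : ℝ) ^ ν := by
    have := Finset.card_le_card hsub
    rw [Fintype.card_piFinset, Finset.prod_const, Finset.card_univ, Fintype.card_fin] at this
    exact_mod_cast this
  refine h2.trans ?_
  rw [← mul_pow]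
  refine pow_le_pow_left₀ (by positivity) ?_ _
  have hf : 0 ≤ ⌊N⌋ := Int.floor_nonneg.2 (by linarith)
  rw [Int.card_Icc]
  have h3 : (((⌊N⌋ + 1 - -⌊N⌋).toNat : ℤ) : ℝ) = 2 * (⌊N⌋ : ℝ) + 1 := by
    rw [Int.toNat_of_nonneg (by linarith)]; push_cast; ring
  have h4 : (((⌊N⌋ + 1 - -⌊N⌋).toNat : ℕ) : ℝ) = 2 * (⌊N⌋ : ℝ) + 1 := by exact_mod_cast h3
  rw [h4]
  linarith [Int.floor_le N]

end Summability

/-! ### Measurability, Fubini and pigeonhole -/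

section Selection

theorem measurable_restrictedOp {ν : ℕ} {Ω : Type*} [MeasurableSpace Ω] (A : (Fin ν → ℤ) → ℝ)
    {V : Ω → (Fin ν → ℤ) → ℝ} (hV : ∀ w, Measurable fun x => V x w) {E : Ω → ℝ}
    (hE : Measurable E) (Λ : Finset (Fin ν → ℤ)) :
    Measurable fun x => (fun u v => (restrictedOp A (V x) Λ - E x • (1 : Matrix Λ Λ ℝ)) u v :
      Λ → Λ → ℝ) := by
  refine measurable_pi_lambda _ fun u => measurable_pi_lambda _ fun v => ?_
  simp only [Matrix.sub_apply, Matrix.smul_apply, restrictedOp, Matrix.of_apply, smul_eq_mul]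
  refine Measurable.sub (measurable_const.add ?_) (hE.mul_const _)
  split_ifs
  · exact hV _
  · exact measurable_const

/-- By Cramer's rule the Green function is the adjugate over the determinant, both continuous in the
matrix entries; the condition on the outer site does not involve `x`. -/
theorem measurableSet_resStar {ν : ℕ} {Ω : Type*} [MeasurableSpace Ω] (A : (Fin ν → ℤ) → ℝ)
    {V : Ω → (Fin ν → ℤ) → ℝ} (hV : ∀ w, Measurable fun x => V x w) {E : Ω → ℝ}
    (hE : Measurable E) (Λ : Finset (Fin ν → ℤ)) (h0 : 0 ∈ Λ) (ε : ℝ) :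
    MeasurableSet {x | E x ∈ resStar A (V x) Λ h0 ε} := by
  have hm := measurable_restrictedOp A hV hE Λ
  have hdet : Measurable fun x => (restrictedOp A (V x) Λ - E x • (1 : Matrix Λ Λ ℝ)).det := by
    have hc : Continuous fun X : Λ → Λ → ℝ => (Matrix.of X).det :=
      Continuous.matrix_det continuous_id
    exact hc.measurable.comp hm
  have hadj : ∀ u v, Measurable fun x =>
      (restrictedOp A (V x) Λ - E x • (1 : Matrix Λ Λ ℝ)).adjugate u v := fun u v => by
    have hc : Continuous fun X : Λ → Λ → ℝ => (Matrix.of X).adjugate u v :=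
      (Continuous.matrix_adjugate continuous_id).matrix_elem u v
    exact hc.measurable.comp hm
  have hg : ∀ u v, Measurable fun x => greenFn A (V x) Λ (E x) u v := fun u v => by
    simp only [greenFn, Matrix.inv_def, Matrix.smul_apply, smul_eq_mul, Ring.inverse_eq_inv']
    exact hdet.inv.mul (hadj u v)
  have heq : {x | E x ∈ resStar A (V x) Λ h0 ε} =
      {x | (restrictedOp A (V x) Λ - E x • (1 : Matrix Λ Λ ℝ)).det ≠ 0} ∩
        ⋃ v : Λ, {x | (∃ w, w ∉ Λ ∧ ε < |A (v.1 - w)|) ∧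
          ε < |greenFn A (V x) Λ (E x) ⟨0, h0⟩ v|} := by
    ext x
    simp only [resStar, Set.mem_ofPred_eq, Matrix.isUnit_iff_isUnit_det, isUnit_iff_ne_zero,
      Set.mem_inter_iff, Set.mem_iUnion]
    refine and_congr_right fun _ => exists_congr fun v => ?_
    constructor
    · rintro ⟨w, h1, h2, h3⟩; exact ⟨⟨w, h1, h3⟩, h2⟩
    · rintro ⟨⟨w, h1, h3⟩, h2⟩; exact ⟨w, h1, h2, h3⟩
  rw [heq]
  refine MeasurableSet.inter (hdet (measurableSet_singleton 0).compl)
    (MeasurableSet.iUnion fun v => ?_)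
  refine MeasurableSet.inter (MeasurableSet.const _) ?_
  exact measurableSet_lt measurable_const (hg _ v).abs

/-- If all sections over the first factor have small measure, then in every set of larger measure
there is a point over which the section over the second factor has small measure. -/
theorem exists_mem_measure_section_le {Ω Ω' : Type*} [MeasurableSpace Ω] [MeasurableSpace Ω']
    {P : Measure Ω} {μ : Measure Ω'} [SFinite P] [SFinite μ] {Bad : Set (Ω × Ω')}
    (hBad : MeasurableSet Bad) {s : Set Ω} {p c : ℝ≥0∞}
    (hp : ∀ α, P {x | (x, α) ∈ Bad} ≤ p) (hs : p * μ Set.univ < c * P s) :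
    ∃ x ∈ s, μ {α | (x, α) ∈ Bad} ≤ c := by
  by_contra! hcon
  have h1 : c * P s ≤ (P.prod μ) Bad := by
    rw [Measure.prod_apply hBad]
    calc c * P s ≤ ∫⁻ x in s, μ (Prod.mk x ⁻¹' Bad) ∂P := by
          rw [← setLIntegral_const]
          exact setLIntegral_mono (measurable_measure_prodMk_left hBad) fun x hx => (hcon x hx).le
      _ ≤ _ := setLIntegral_le_lintegral _ _
  have h2 : (P.prod μ) Bad ≤ p * μ Set.univ := by
    rw [Measure.prod_apply_symm hBad, ← lintegral_const]
    exact lintegral_mono hp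
  exact absurd (hs.trans_le (h1.trans h2)) (lt_irrefl _)

/-- Pigeonhole: one of finitely many sets which leave out at most half of a finite measure space has
at least the average measure. -/
theorem exists_measure_real_ge {Ω : Type*} [MeasurableSpace Ω] (μ : Measure Ω) [IsFiniteMeasure μ]
    {M : ℕ} (hM : 1 ≤ M) (S : Fin M → Set Ω)
    (hS : μ.real (⋃ m, S m)ᶜ ≤ μ.real Set.univ / 2) (hSm : ∀ m, MeasurableSet (S m)) :
    ∃ m, μ.real Set.univ / (2 * M) ≤ μ.real (S m) := by
  by_contra! hcon
  have hM0 : (0 : ℝ) < M := by exact_mod_cast hM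
  have : NeZero M := ⟨by omega⟩
  have h1 : μ.real (⋃ m, S m) ≤ ∑ m, μ.real (S m) := measureReal_iUnion_fintype_le _
  have h2 : ∑ m, μ.real (S m) < ∑ _m : Fin M, μ.real Set.univ / (2 * M) :=
    Finset.sum_lt_sum_of_nonempty Finset.univ_nonempty fun m _ => hcon m
  have h3 : ∑ _m : Fin M, μ.real Set.univ / (2 * M) = μ.real Set.univ / 2 := by
    rw [Finset.sum_const, Finset.card_univ, Fintype.card_fin, nsmul_eq_mul]
    field_simp
  have h4 := measureReal_add_measureReal_compl (μ := μ) (MeasurableSet.iUnion hSm)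
  linarith

theorem ofReal_rpow_le_mul_measure_closedBall {Θ : Type*} [MetricSpace Θ] [MeasurableSpace Θ]
    {P : Measure Θ} [IsFiniteMeasure P] {k : ℝ} {K : ℝ≥0}
    (hK : upperMinkowskiContent k P ≤ K) (θ : Θ) {r : ℝ}
    (hr0 : 0 < r) (hr1 : r ≤ 1) :
    ENNReal.ofReal (r ^ k) ≤ K * P (Metric.closedBall θ r) := by
  have h : ENNReal.ofReal (r ^ k) / P (Metric.closedBall θ r) ≤ K := by
    refine le_trans ?_ hK
    unfold upperMinkowskiContent
    exact le_iSup_of_le θ (le_iSup_of_le r (le_iSup_of_le ⟨hr0, hr1⟩ le_rfl))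
  exact (ENNReal.div_le_iff_le_mul (Or.inr ENNReal.coe_ne_top) (Or.inl (measure_ne_top _ _))).1 h

end Selection

/-! ### From resolvents to transport; choice of the phase -/

section Transport

variable {ν : ℕ}

theorem transportProb_le_one {A V : (Fin ν → ℤ) → ℝ} {B : ℝ} (hsymm : ∀ w, A (-w) = A w)
    (hA : Summable fun w => |A w|) (hV : ∀ w, |V w| ≤ B) (t : ℝ) (w : Fin ν → ℤ) :
    transportProb A V t w ≤ 1 := by
  refine pow_le_one₀ (norm_nonneg _) ((norm_apply_le_norm _ _).trans ?_)
  refine (ContinuousLinearMap.le_of_opNorm_le _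
    (norm_exp_I_smul_le_one (isSelfAdjoint_latticeOp A V hsymm hA hV) t) _).trans ?_
  rw [one_mul, lp.norm_single two_pos, norm_one]

/-- A bound on the resolvent at the energies `x - iδ` yields a bound on the quantum transport up to
times of order `1 / δ`. -/
theorem transportProb_le_of_resolvent {A V : (Fin ν → ℤ) → ℝ} {ς a B δ t β R : ℝ} (hς : 0 < ς)
    (hsymm : ∀ w, A (-w) = A w) (hA : Summable fun w => |A w| * Real.exp (ς * ‖w‖))
    (ha : ∑' w, |A w| * Real.exp (ς * ‖w‖) ≤ a) (hV : ∀ w, |V w| ≤ B) (hR : a + B + 1 ≤ R)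
    (hδ : 0 < δ) (hδ1 : δ ≤ 1) (ht : 0 ≤ t) (htδ : t * δ ≤ 1) (w : Fin ν → ℤ)
    (hres : ∀ (x : ℝ) (φ : LatticeL2 ν), ‖φ‖ ≤ 1 / δ →
      ((x : ℂ) - Complex.I * δ) • φ - latticeOp A V φ = lp.single 2 w (1 : ℂ) → ‖φ 0‖ ≤ β) :
    transportProb A V t w ≤ 2 * Real.exp 1 ^ 2 *
      ((2 * R) ^ 2 * β ^ 2 + (4 * R + 2) ^ 2 * Real.exp (-ς * ‖w‖)) := by
  have hA1 := summable_abs_of_summable_exp hς hA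
  have hB : 0 ≤ B := (abs_nonneg _).trans (hV 0)
  have ha0 : 0 ≤ a := le_trans (tsum_nonneg fun _ => by positivity) ha
  have hH := isSelfAdjoint_latticeOp A V hsymm hA1 hV
  have hHn : ‖latticeOp A V‖ < R := by
    have h1 := norm_latticeOp_le A V hA1 hV
    have h2 := tsum_abs_le_tsum_exp hς hA
    linarith
  set ψ : LatticeL2 ν := lp.single 2 w (1 : ℂ) with hψ
  have hψ1 : ‖ψ‖ = 1 := by rw [hψ, lp.norm_single two_pos, norm_one]
  set ℓ : (LatticeL2 ν →L[ℂ] LatticeL2 ν) →L[ℂ] ℂ :=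
    (lp.evalCLM ℂ (fun _ : Fin ν → ℤ => ℂ) 2 0).comp
      (ContinuousLinearMap.apply ℂ (LatticeL2 ν) ψ) with hℓ
  have hℓa : ∀ S, ℓ S = S ψ 0 := fun S => rfl
  have hkey := norm_apply_exp_le (β₁ := β) (β₂ := Real.exp (-(ς * ‖w‖))) hH hHn hδ ht ℓ
    (fun x _ => by
      rw [hℓa]
      refine hres x _ ?_ (resolvent_apply_eq hH (fun lam hl h => ?_) ψ)
      · refine (ContinuousLinearMap.le_of_opNorm_le _ (norm_resolvent_le hH x hδ) _).trans ?_
        rw [hψ1, mul_one]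
      · obtain ⟨r, rfl, -⟩ := hH.exists_ofReal_of_mem_spectrum hl
        have := congrArg Complex.im h
        simp at this
        exact hδ.ne' this)
    (fun z hz => by
      rw [hℓa]
      have := norm_resolvent_apply_le_exp hς hA ha hV (hR.trans hz) w
        (resolvent_apply_eq hH (fun lam hl h => ?_) ψ) 0
      · rwa [zero_sub, norm_neg] at this
      · obtain ⟨r, rfl, hr⟩ := hH.exists_ofReal_of_mem_spectrum hl
        rw [h, Complex.norm_real, Real.norm_eq_abs] at hz
        linarith)
  rw [hℓa] at hkey
  have hR0 : 0 ≤ R := by linarith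
  have hβ : 0 ≤ β := by
    refine (norm_nonneg _).trans (hres 0 _ ?_ (resolvent_apply_eq hH (fun lam hl h => ?_) ψ))
    · refine (ContinuousLinearMap.le_of_opNorm_le _ (norm_resolvent_le hH 0 hδ) _).trans ?_
      rw [hψ1, mul_one]
    · obtain ⟨r, rfl, -⟩ := hH.exists_ofReal_of_mem_spectrum hl
      have := congrArg Complex.im h
      simp at this
      exact hδ.ne' this
  have he : Real.exp (t * δ) ≤ Real.exp 1 := Real.exp_le_exp.2 htδ
  set u := Real.exp (-(ς * ‖w‖)) with hu
  have hu0 : 0 < u := Real.exp_pos _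
  have hu1 : u ≤ 1 := Real.exp_le_one_iff.2 (by simp; positivity)
  have hle : ‖(NormedSpace.exp ((Complex.I * (t : ℂ)) • latticeOp A V) :
      LatticeL2 ν →L[ℂ] LatticeL2 ν) ψ 0‖ ≤ Real.exp 1 * (2 * R * β + (4 * R + 2) * u) := by
    refine hkey.trans ?_
    gcongr
    linarith
  rw [transportProb, neg_mul, ← hu]
  calc _ ≤ (Real.exp 1 * (2 * R * β + (4 * R + 2) * u)) ^ 2 :=
        pow_le_pow_left₀ (norm_nonneg _) hle 2
    _ = Real.exp 1 ^ 2 * (2 * R * β + (4 * R + 2) * u) ^ 2 := by ring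
    _ ≤ Real.exp 1 ^ 2 * (2 * ((2 * R * β) ^ 2 + ((4 * R + 2) * u) ^ 2)) := by
        gcongr; exact add_sq_le
    -- `u ≤ 1` allows `u² ≤ u`, so the rate `ς` of the resolvent is kept.
    _ ≤ Real.exp 1 ^ 2 * (2 * ((2 * R) ^ 2 * β ^ 2 + (4 * R + 2) ^ 2 * u)) := by
        rw [mul_pow (2 * R) β, mul_pow (4 * R + 2) u]
        gcongr
        nlinarith
    _ = _ := by ring

/-- A nearby phase `θ'` such that, outside a set of angles of at most half of the circle, the
boundary energies seen from `x - iη` avoid the intersection of the sets `Res*`. -/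
theorem exists_phase_mem_closedBall {Θ : Type*} [MetricSpace Θ] [MeasurableSpace Θ]
    [OpensMeasurableSpace Θ] {P : Measure Θ} [IsProbabilityMeasure P]
    [AddAction (Fin ν → ℤ) Θ] [MeasurableConstVAdd (Fin ν → ℤ) Θ]
    {k χ δ ε : ℝ} {K : ℝ≥0} (hK : upperMinkowskiContent k P ≤ K)
    (hχ : 1 ≤ χ) {A : (Fin ν → ℤ) → ℝ} {F : Θ → ℝ} (hF : Continuous F) {M : ℕ}
    (Λ : Fin M → Finset (Fin ν → ℤ)) (h0 : ∀ m, 0 ∈ Λ m) (hδ : 0 < δ) (hδ1 : δ ≤ 1)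
    (hKδ : 2 * K * δ < 1)
    (hP : ∀ E : ℝ, P {θ | E ∈ ⋂ m, resStar A (ergodicPotential F θ) (Λ m) (h0 m) ε}
      ≤ ENNReal.ofReal (δ ^ ((2 + χ) * k + 1)))
    (θ : Θ) (x η : ℝ) :
    ∃ θ' ∈ Metric.closedBall θ (δ ^ (2 + χ)),
      (volume.restrict (Set.Ioc 0 (2 * Real.pi)))
        {α | circleEnergy x η α ∈ ⋂ m, resStar A (ergodicPotential F θ') (Λ m) (h0 m) ε}
        ≤ ENNReal.ofReal Real.pi := by
  have hr0 : 0 < δ ^ (2 + χ) := by positivity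
  have hr1 : δ ^ (2 + χ) ≤ 1 := Real.rpow_le_one hδ.le hδ1 (by linarith)
  have hball := ofReal_rpow_le_mul_measure_closedBall hK θ hr0 hr1
  refine exists_mem_measure_section_le (P := P)
    (Bad := {y : Θ × ℝ | circleEnergy x η y.2 ∈
      ⋂ m, resStar A (ergodicPotential F y.1) (Λ m) (h0 m) ε})
    ?_ (fun α => hP (circleEnergy x η α)) ?_
  · have : {y : Θ × ℝ | circleEnergy x η y.2 ∈
        ⋂ m, resStar A (ergodicPotential F y.1) (Λ m) (h0 m) ε} =
        ⋂ m, {y : Θ × ℝ | circleEnergy x η y.2 ∈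
          resStar A (ergodicPotential F y.1) (Λ m) (h0 m) ε} := by
      ext y; simp
    rw [this]
    refine MeasurableSet.iInter fun m => measurableSet_resStar A (fun w => ?_)
      ((measurable_circleEnergy x η).comp measurable_snd) _ _ _
    exact hF.measurable.comp ((measurable_const_vadd w).comp measurable_fst)
  · have hpi := Real.pi_pos
    set Q := δ ^ ((2 + χ) * k) with hQ
    have hQ0 : 0 < Q := by positivity
    -- The content bound makes the ball at least as large as `Q / K`, while the bad probability is
    -- `δ Q`; the condition `2 K δ < 1` pays for the quotient of `2π` and `π`.
    have hb : Q ≤ K * P.real (Metric.closedBall θ (δ ^ (2 + χ))) := by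
      rw [← Real.rpow_mul hδ.le, ← ofReal_measureReal, ← ENNReal.ofReal_coe_nnreal,
        ← ENNReal.ofReal_mul K.coe_nonneg] at hball
      exact (ENNReal.ofReal_le_ofReal_iff (by positivity)).1 hball
    rw [Measure.restrict_apply_univ, Real.volume_Ioc, sub_zero,
      ← ENNReal.ofReal_mul (by positivity), ← ofReal_measureReal,
      ← ENNReal.ofReal_mul hpi.le]
    set p := P.real (Metric.closedBall θ (δ ^ (2 + χ))) with hp
    have hp0 : 0 < p := by
      rcases (measureReal_nonneg (μ := P) (s := Metric.closedBall θ (δ ^ (2 + χ)))).lt_or_eq with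
        h | h
      · exact h
      · rw [← hp] at h
        rw [← h, mul_zero] at hb
        linarith
    refine (ENNReal.ofReal_lt_ofReal_iff (by positivity)).2 ?_
    rw [Real.rpow_add hδ, Real.rpow_one, ← hQ]
    have h1 : 2 * δ * Q ≤ 2 * K * δ * p := by nlinarith
    have h2 : 2 * K * δ * p < 1 * p := mul_lt_mul_of_pos_right hKδ hp0
    nlinarith

/-- `(Nδ)^χ ≤ Nδ ≤ √δ`. Thus the part `δ^χ` of the radius `δ^{2+χ}` absorbs the spreading `N^χ` of
orbits and leaves `√δ` over. -/
theorem rpow_mul_rpow_le_sqrt {N δ χ : ℝ} (hχ : 1 ≤ χ) (hN : 1 ≤ N) (hδ : 0 < δ)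
    (hNδ : N ^ 2 * δ ≤ 1) : N ^ χ * δ ^ χ ≤ Real.sqrt δ := by
  have hN0 : 0 ≤ N := by linarith
  have hδ1 : δ ≤ 1 := (le_mul_of_one_le_left hδ.le (one_le_pow₀ hN)).trans hNδ
  have h1 : N * δ ≤ Real.sqrt δ := by
    refine Real.le_sqrt_of_sq_le ?_
    nlinarith
  have h2 : N * δ ≤ 1 := h1.trans (Real.sqrt_le_one.2 hδ1)
  rw [← Real.mul_rpow hN0 hδ.le]
  refine le_trans ?_ h1
  have := Real.rpow_le_rpow_of_exponent_ge (by positivity : 0 < N * δ) h2 hχ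
  rwa [Real.rpow_one] at this

theorem abs_sub_ergodicPotential_le {Θ : Type*} [MetricSpace Θ] [AddAction (Fin ν → ℤ) Θ]
    {χ D N δ : ℝ} {L : ℝ≥0} (hχ : 1 ≤ χ)
    (hD : ∀ (w : Fin ν → ℤ) (θ θ' : Θ),
      dist (w +ᵥ θ) (w +ᵥ θ') ≤ D * (‖w‖ + 1) ^ χ * dist θ θ')
    {F : Θ → ℝ} (hF : LipschitzWith L F) (hN : 1 ≤ N) (hδ : 0 < δ) (hNδ : N ^ 2 * δ ≤ 1)
    {θ θ' : Θ} (hθ : θ' ∈ Metric.closedBall θ (δ ^ (2 + χ))) {v : Fin ν → ℤ} (hv : ‖v‖ ≤ N) :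
    |ergodicPotential F θ v - ergodicPotential F θ' v|
      ≤ L * |D| * 2 ^ χ * (δ ^ 2 * Real.sqrt δ) := by
  have h1 : |ergodicPotential F θ v - ergodicPotential F θ' v| ≤
      L * dist (v +ᵥ θ) (v +ᵥ θ') := by
    rw [← Real.dist_eq]; exact hF.dist_le_mul _ _
  have h2 : dist θ θ' ≤ δ ^ (2 + χ) := by rw [dist_comm]; exact hθ
  have h3 : (‖v‖ + 1) ^ χ ≤ 2 ^ χ * N ^ χ := by
    rw [← Real.mul_rpow (by norm_num) (by linarith)]
    exact Real.rpow_le_rpow (by positivity) (by linarith) (by linarith)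
  have h4 : dist (v +ᵥ θ) (v +ᵥ θ') ≤ |D| * (2 ^ χ * N ^ χ) * δ ^ (2 + χ) := by
    refine (hD v θ θ').trans ?_
    gcongr
    exact le_abs_self D
  have h5 := rpow_mul_rpow_le_sqrt hχ hN hδ hNδ
  have h6 : δ ^ (2 + χ) = δ ^ 2 * δ ^ χ := by
    rw [Real.rpow_add hδ]; norm_num
  calc _ ≤ L * (|D| * (2 ^ χ * N ^ χ) * δ ^ (2 + χ)) :=
        h1.trans (mul_le_mul_of_nonneg_left h4 L.coe_nonneg)
    _ = L * |D| * 2 ^ χ * (δ ^ 2 * (N ^ χ * δ ^ χ)) := by rw [h6]; ring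
    _ ≤ _ := by gcongr

/-- Harmonic measure at least `1/(2M)` turns the exponent `8(ν+1)M` into at least `4(ν+1) ≥ 4`. -/
theorem pow_rpow_le_pow_four {δ om : ℝ} (hδ : 0 < δ) (hδ1 : δ ≤ 1) {M : ℕ} (hM : 1 ≤ M)
    (hom : 1 / (2 * (M : ℝ)) ≤ om) : (δ ^ (8 * (ν + 1) * M)) ^ om ≤ δ ^ 4 := by
  have hM0 : (0 : ℝ) < M := by exact_mod_cast hM
  rw [← Real.rpow_natCast, ← Real.rpow_mul hδ.le, ← Real.rpow_natCast]
  refine Real.rpow_le_rpow_of_exponent_ge hδ hδ1 ?_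
  push_cast
  have h1 : 8 * ((ν : ℝ) + 1) * M * (1 / (2 * (M : ℝ))) ≤ 8 * ((ν : ℝ) + 1) * M * om := by gcongr
  have h2 : 8 * ((ν : ℝ) + 1) * M * (1 / (2 * (M : ℝ))) = 4 * (ν + 1) := by field_simp; ring
  have h3 : (0 : ℝ) ≤ ν := Nat.cast_nonneg ν
  linarith

theorem sqrt_pow_le_pow_four {δ : ℝ} (hδ : 0 < δ) (hδ1 : δ ≤ 1) {M : ℕ} (hM : 1 ≤ M) :
    Real.sqrt (δ ^ (8 * (ν + 1) * M)) ≤ δ ^ 4 := by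
  rw [Real.sqrt_eq_rpow]
  refine pow_rpow_le_pow_four hδ hδ1 hM ?_
  have : (1 : ℝ) ≤ M := by exact_mod_cast hM
  gcongr
  linarith

end Transport

/-! ### The resolvent bound and the choice of constants -/

section Main

/-- Under the large deviation hypothesis, the resolvent between `0` and a site at distance more than
`N` is of order `N ^ ν * √δ` at all energies `x - iδ`. -/
theorem norm_resolvent_apply_zero_le_sqrt {ν : ℕ} (hν : 1 ≤ ν) {Θ : Type*} [MetricSpace Θ]
    [MeasurableSpace Θ] [OpensMeasurableSpace Θ] {P : Measure Θ} [IsProbabilityMeasure P]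
    [AddAction (Fin ν → ℤ) Θ] [MeasurableConstVAdd (Fin ν → ℤ) Θ]
    {k χ δ D N ς a B : ℝ} {K L : ℝ≥0} (hK : upperMinkowskiContent k P ≤ K) (hχ : 1 ≤ χ)
    (hς : 0 < ς) {A : (Fin ν → ℤ) → ℝ} (hsymm : ∀ w, A (-w) = A w)
    (hA : Summable fun w => |A w| * Real.exp (ς * ‖w‖))
    (ha : ∑' w, |A w| * Real.exp (ς * ‖w‖) ≤ a)
    (hD : ∀ (w : Fin ν → ℤ) (θ θ' : Θ),
      dist (w +ᵥ θ) (w +ᵥ θ') ≤ D * (‖w‖ + 1) ^ χ * dist θ θ')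
    {F : Θ → ℝ} (hF : LipschitzWith L F) (hB : ∀ θ, |F θ| ≤ B) {M : ℕ} (hM : 1 ≤ M)
    (hN : 1 ≤ N) (Λ : Fin M → Finset (Fin ν → ℤ)) (h0 : ∀ m, 0 ∈ Λ m)
    (hΛ : ∀ m, ∀ w ∈ Λ m, ‖w‖ ≤ N) (hδ : 0 < δ) (hδ1 : δ ≤ 1) (hKδ : 2 * K * δ < 1)
    (hNδ : N ^ (2 * ν) * δ ≤ 1)
    (hP : ∀ E : ℝ,
      P {θ | E ∈ ⋂ m, resStar A (ergodicPotential F θ) (Λ m) (h0 m) (δ ^ (8 * (ν + 1) * M))}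
        ≤ ENNReal.ofReal (δ ^ ((2 + χ) * k + 1)))
    {w : Fin ν → ℤ} (hw : N < ‖w‖) (θ : Θ) (x : ℝ) {φ : LatticeL2 ν} (hφn : ‖φ‖ ≤ 1 / δ)
    (hφ : ((x : ℂ) - Complex.I * δ) • φ - latticeOp A (ergodicPotential F θ) φ =
      lp.single 2 w (1 : ℂ)) :
    ‖φ 0‖ ≤ 3 ^ ν * (25 * a + 2 * (a + ∑' u : Fin ν → ℤ, Real.exp (-(ς * ‖u‖))) +
      2 * (L * |D| * 2 ^ χ)) * (N ^ ν * Real.sqrt δ) := by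
  have hA1 := summable_abs_of_summable_exp hς hA
  have ha1 : ∑' w, |A w| ≤ a := (tsum_abs_le_tsum_exp hς hA).trans ha
  have ha0 : 0 ≤ a := (tsum_nonneg fun _ => abs_nonneg _).trans ha1
  have hpi := Real.pi_pos
  have hN2 : N ^ 2 * δ ≤ 1 :=
    (mul_le_mul_of_nonneg_right (pow_le_pow_right₀ hN (by omega)) hδ.le).trans hNδ
  obtain ⟨θ', hθ', hbad⟩ := exists_phase_mem_closedBall hK hχ hF.continuous Λ h0 hδ hδ1 hKδ hP θ x δ
  set ε : ℝ := δ ^ (8 * (ν + 1) * M) with hε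
  have hε0 : 0 < ε := by positivity
  set μ := volume.restrict (Set.Ioc 0 (2 * Real.pi)) with hμ
  have hμ1 : μ.real Set.univ = 2 * Real.pi := by
    rw [hμ, measureReal_restrict_apply_univ, Real.volume_real_Ioc_of_le (by positivity), sub_zero]
  set S : Fin M → Set ℝ := fun m =>
    {α | circleEnergy x δ α ∈ resStar A (ergodicPotential F θ') (Λ m) (h0 m) ε}ᶜ with hS
  have hSm : ∀ m, MeasurableSet (S m) := fun m =>
    (measurableSet_resStar (Ω := ℝ) A (V := fun _ => ergodicPotential F θ')
      (fun w => measurable_const) (measurable_circleEnergy x δ) (Λ m) (h0 m) ε).compl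
  -- The bad angles, resonant for all volumes at once, form the complement of the union of the good
  -- sets `S m` and fill at most half of the circle.
  obtain ⟨m, hm⟩ := exists_measure_real_ge μ hM S (by
    have : (⋃ m, S m)ᶜ = {α | circleEnergy x δ α ∈
        ⋂ m, resStar A (ergodicPotential F θ') (Λ m) (h0 m) ε} := by
      ext α; simp [hS]
    rw [this, hμ1, mul_div_cancel_left₀ _ two_ne_zero]
    exact ENNReal.toReal_le_of_le_ofReal hpi.le hbad) hSm
  rw [hμ1] at hm
  have hom : 1 / (2 * (M : ℝ)) ≤ μ.real (S m) / (2 * Real.pi) := by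
    rw [le_div_iff₀ (by positivity)]
    refine le_trans (le_of_eq ?_) hm
    ring
  have key := norm_resolvent_apply_zero_le (V' := ergodicPotential F θ')
    (κ := L * |D| * 2 ^ χ * (δ ^ 2 * Real.sqrt δ)) hsymm hA1 ha1
    (summable_sqrt_abs hς hA) (fun w => hB (w +ᵥ θ)) (h0 m)
    (fun v hv => abs_sub_ergodicPotential_le hχ hD hF hN hδ hN2 hθ' (hΛ m v hv))
    (fun h => (hΛ m w h).not_gt hw) hδ hε0 (hSm m) (fun α hα => hα) hφn hφ
  rw [← hμ] at key
  have e1 := pow_rpow_le_pow_four (ν := ν) hδ hδ1 hM hom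
  have e2 := sqrt_pow_le_pow_four (ν := ν) hδ hδ1 hM
  rw [← hε] at e1 e2
  have hQ := (tsum_sqrt_abs_le hς hA).trans (add_le_add_left ha _)
  have hcard := card_le_of_norm_le hN (hΛ m)
  set Q := ∑' u, Real.sqrt |A u| with hQd
  have hQ0 : 0 ≤ Q := tsum_nonneg fun _ => Real.sqrt_nonneg _
  set Ex := ∑' u : Fin ν → ℤ, Real.exp (-(ς * ‖u‖)) with hEx
  set κ₀ := (L : ℝ) * |D| * 2 ^ χ with hκ₀
  have hκ0 : 0 ≤ κ₀ := by positivity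
  set s := Real.sqrt δ with hs
  have hs0 : 0 ≤ s := Real.sqrt_nonneg _
  have hδs : δ ≤ s := Real.le_sqrt_of_sq_le (by nlinarith)
  -- Power counting: `δ⁻¹ δ⁴ δ⁻² = δ`, `δ⁻² δ⁴ = δ²` and `δ⁻² δ² √δ = √δ`; the change of potential
  -- dominates.
  have hin : 1 / δ * (a * (ε ^ (μ.real (S m) / (2 * Real.pi)) * (1 + 4 / δ) ^ 2) +
      2 / δ * (Real.sqrt ε * Q)) + 2 / δ * (κ₀ * (δ ^ 2 * s) * (1 / δ))
      ≤ (25 * a + 2 * (a + Ex) + 2 * κ₀) * s := by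
    have h5 : (1 + 4 / δ) ^ 2 ≤ 25 / δ ^ 2 := by
      have : 1 + 4 / δ ≤ 5 / δ := by
        rw [le_div_iff₀ hδ, add_mul, div_mul_cancel₀ _ hδ.ne']; linarith
      calc (1 + 4 / δ) ^ 2 ≤ (5 / δ) ^ 2 := by gcongr
        _ = _ := by rw [div_pow]; norm_num
    calc _ ≤ 1 / δ * (a * (δ ^ 4 * (25 / δ ^ 2)) + 2 / δ * (δ ^ 4 * (a + Ex))) +
          2 / δ * (κ₀ * (δ ^ 2 * s) * (1 / δ)) := by gcongr
      _ = 25 * a * δ + 2 * (a + Ex) * (δ * δ) + 2 * κ₀ * s := by field_simp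
      _ ≤ 25 * a * s + 2 * (a + Ex) * (1 * s) + 2 * κ₀ * s := by
          have : 0 ≤ a + Ex := hQ0.trans hQ
          gcongr
      _ = _ := by ring
  refine key.trans ?_
  have hpos : 0 ≤ (25 * a + 2 * (a + Ex) + 2 * κ₀) * s := by
    have : 0 ≤ a + Ex := hQ0.trans hQ
    positivity
  calc _ ≤ ((Λ m).card : ℝ) * ((25 * a + 2 * (a + Ex) + 2 * κ₀) * s) := by gcongr
    _ ≤ 3 ^ ν * N ^ ν * ((25 * a + 2 * (a + Ex) + 2 * κ₀) * s) := by gcongr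
    _ = _ := by ring

end Main

theorem corollary3p1
    (ν : ℕ) (ς : ℝ) (hς : 0 < ς) (a B : ℝ) :
    ∃ c : ℝ, 0 < c ∧
    ∀ (k : ℝ) (_ : 0 ≤ k) (K : ℝ≥0) (χ : ℝ) (_ : 1 ≤ χ) (D : ℝ) (L : ℝ≥0),
    ∃ C : ℝ, 0 < C ∧
    -- the kernel
    ∀ (A : (Fin ν → ℤ) → ℝ) (_ : ∀ w, A (-w) = A w)
      (_ : Summable fun w => |A w| * Real.exp (ς * ‖w‖))
      (_ : ∑' w, |A w| * Real.exp (ς * ‖w‖) ≤ a)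
      -- the metric probability space and the ergodic action
      (Θ : Type*) [MetricSpace Θ] [MeasurableSpace Θ] [OpensMeasurableSpace Θ]
      (P : Measure Θ) [IsProbabilityMeasure P]
      [AddAction (Fin ν → ℤ) Θ] [MeasurableConstVAdd (Fin ν → ℤ) Θ]
      [ErgodicVAdd (Fin ν → ℤ) Θ P]
      (_ : upperMinkowskiContent k P ≤ K)
      (_ : ∀ (w : Fin ν → ℤ) (θ θ' : Θ), dist (w +ᵥ θ) (w +ᵥ θ') ≤ D * (‖w‖ + 1) ^ χ * dist θ θ')
      -- the hull function
      (F : Θ → ℝ) (_ : LipschitzWith L F) (_ : ∀ θ, |F θ| ≤ B)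
      -- the finite volumes
      (M : ℕ) (_ : 1 ≤ M) (N : ℝ) (_ : 1 ≤ N)
      (Λ : Fin M → Finset (Fin ν → ℤ)) (h0 : ∀ m, 0 ∈ Λ m) (_ : ∀ m, ∀ w ∈ Λ m, ‖w‖ ≤ N)
      (δ : ℝ) (_ : 0 < δ) (_ : δ ≤ 1)
      -- the large deviation hypothesis
      (_ : ∀ E : ℝ,
        P {θ | E ∈ ⋂ m, resStar A (ergodicPotential F θ) (Λ m) (h0 m) (δ ^ (8 * (ν + 1) * M))}
          ≤ ENNReal.ofReal (δ ^ ((2 + χ) * k + 1))),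
    ∀ (w : Fin ν → ℤ), N < ‖w‖ → ∀ t : ℝ, 0 ≤ t → t ≤ 1 / δ → ∀ θ : Θ,
      transportProb A (ergodicPotential F θ) t w
        ≤ C * (N ^ (2 * ν) * δ + Real.exp (-c * ‖w‖)) := by

  set E₀ : ℝ := ∑' u : Fin ν → ℤ, Real.exp (-(ς * ‖u‖)) with hE₀
  have hE₀0 : 0 ≤ E₀ := tsum_nonneg fun _ => (Real.exp_pos _).le
  refine ⟨ς, hς, fun k hk K χ hχ D L => ?_⟩
  set R : ℝ := |a| + |B| + 1 with hR
  have hR0 : 0 ≤ R := by positivity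
  set C₁ : ℝ := 3 ^ ν * (25 * |a| + 2 * (|a| + E₀) + 2 * (L * |D| * 2 ^ χ)) with hC₁
  have hC₁0 : 0 ≤ C₁ := by positivity
  -- The summand `1 + 2K` ensures that `C N^{2ν} δ < 1` implies both `N^{2ν} δ ≤ 1` and `2Kδ < 1`;
  -- the rest is the constant of the transport estimate.
  set C : ℝ := 1 + 2 * K + 2 * Real.exp 1 ^ 2 * ((2 * R) ^ 2 * C₁ ^ 2 + (4 * R + 2) ^ 2) with hC
  have hC2 : 2 * Real.exp 1 ^ 2 * ((2 * R) ^ 2 * C₁ ^ 2 + (4 * R + 2) ^ 2) ≤ C := by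
    have := K.coe_nonneg
    linarith
  have hC1 : 1 + 2 * K ≤ C := le_add_of_nonneg_right (by positivity)
  have hCpos : 0 < C := lt_of_lt_of_le (by positivity) hC1
  refine ⟨C, hCpos, ?_⟩
  intro A hsymm hA ha Θ _ _ _ P _ _ _ _ hK hD F hF hB M hM N hN Λ h0 hΛ δ hδ hδ1 hP w hw t ht htδ θ
  have ha0 : 0 ≤ a := le_trans (tsum_nonneg fun _ => by positivity) ha
  have hB0 : 0 ≤ B := (abs_nonneg _).trans (hB θ)
  have hexp : 0 < Real.exp (-ς * ‖w‖) := Real.exp_pos _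
  have hNpow : 1 ≤ N ^ (2 * ν) := one_le_pow₀ hN
  -- If the right-hand side is at least 1, unitarity suffices.
  by_cases htriv : 1 ≤ C * (N ^ (2 * ν) * δ)
  · refine (transportProb_le_one hsymm (summable_abs_of_summable_exp hς hA)
      (fun v => hB (v +ᵥ θ)) t w).trans (htriv.trans ?_)
    exact mul_le_mul_of_nonneg_left (le_add_of_nonneg_right hexp.le) hCpos.le
  push Not at htriv
  have hNδ : N ^ (2 * ν) * δ ≤ 1 := by
    have : 1 * (N ^ (2 * ν) * δ) ≤ C * (N ^ (2 * ν) * δ) := by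
      gcongr
      linarith [K.coe_nonneg]
    linarith
  have hKδ : 2 * K * δ < 1 := by
    refine lt_of_le_of_lt ?_ htriv
    calc 2 * K * δ ≤ C * (1 * δ) := by
          rw [one_mul]; gcongr; linarith
      _ ≤ _ := by gcongr
  -- For `ν = 0` the only site has norm 0, so `‖w‖ > N ≥ 1` is impossible.
  have hν : 1 ≤ ν := by
    rcases Nat.eq_zero_or_pos ν with rfl | h
    · have : w = 0 := Subsingleton.elim _ _
      rw [this, norm_zero] at hw
      linarith
    · exact h
  have hmain := transportProb_le_of_resolvent (R := R) (β := C₁ * (N ^ ν * Real.sqrt δ)) hς hsymm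
    hA ha (fun v => hB (v +ᵥ θ)) (by rw [hR, abs_of_nonneg ha0, abs_of_nonneg hB0]) hδ hδ1 ht
    (by rwa [le_div_iff₀ hδ] at htδ) w
    (fun x φ hφn hφ => by
      have := norm_resolvent_apply_zero_le_sqrt hν hK hχ hς hsymm hA ha hD hF hB hM hN Λ h0 hΛ hδ
        hδ1 hKδ hNδ hP hw θ x hφn hφ
      rwa [hC₁, abs_of_nonneg ha0])
  refine hmain.trans ?_
  have hsq : (C₁ * (N ^ ν * Real.sqrt δ)) ^ 2 = C₁ ^ 2 * (N ^ (2 * ν) * δ) := by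
    rw [mul_pow C₁, mul_pow (N ^ ν), Real.sq_sqrt hδ.le, ← pow_mul, mul_comm ν 2]
  rw [hsq]
  have hX : 0 ≤ N ^ (2 * ν) * δ := by positivity
  calc _ = 2 * Real.exp 1 ^ 2 * ((2 * R) ^ 2 * C₁ ^ 2) * (N ^ (2 * ν) * δ) +
        2 * Real.exp 1 ^ 2 * (4 * R + 2) ^ 2 * Real.exp (-ς * ‖w‖) := by ring
    _ ≤ C * (N ^ (2 * ν) * δ) + C * Real.exp (-ς * ‖w‖) := by
        have h1 : 0 ≤ 2 * Real.exp 1 ^ 2 * ((2 * R) ^ 2 * C₁ ^ 2) := by positivity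
        have h2 : 0 ≤ 2 * Real.exp 1 ^ 2 * (4 * R + 2) ^ 2 := by positivity
        rw [mul_add] at hC2
        gcongr <;> linarith
    _ = _ := by ring
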